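/- Let $\Lambda$ be an artin algebra, let $\operatorname{mod}\Lambda$ be the category of finitely generated left $\Lambda$-modules, and let $e\in\Lambda$ be an idempotent. Put $P=\Lambda e$, $\Gamma=\operatorname{End}_\Lambda(P)^{op}$ and $\mathfrak A=\Lambda e\Lambda$ (every idempotent ideal of $\Lambda$ has this form). Assume that $\mathfrak A$ is a strong idempotent ideal, that is, for all $i\ge 0$ and all $X,Y\in\operatorname{mod}\Lambda/\mathfrak A$ the canonical map $\operatorname{Ext}^i_{\Lambda/\mathfrak A}(X,Y)\to\operatorname{Ext}^i_\Lambda(X,Y)$ is an isomorphism. Let $\mathbb T$ be the full subcategory of $\operatorname{mod}\Lambda$ of all modules $T$ with $\operatorname{Ext}^i_\Lambda(\Lambda/\mathfrak A,T)=0$ for all $i\ge1$. For an artin algebra $A$, let $K_0(A)$ be the abelian group generated by the symbols $[M]$, $M\in\operatorname{mod}A$, modulo the relations $[C]=[X]+[Y]$ whenever $C\simeq X\oplus Y$, and $[I]=0$ for $I$ injective. Let $\Omega^{-1}:K_0(A)\to K_0(A)$ be the homomorphism induced by the cosyzygy, $[M]\mapsto[\Omega^{-1}M]$, and write $\Omega^{-s}$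 for its $s$-fold iterate. For $M\in\operatorname{mod}A$ let $\langle\operatorname{add}M\rangle\subseteq K_0(A)$ be the subgroup generated by the classes of the indecomposable direct summands of $M$. Let $\phi_r(M)$ be the least integer $n\ge 0$ such that $\Omega^{-1}:\Omega^{-s}\langle\operatorname{add}M\rangle\to\Omega^{-(s+1)}\langle\operatorname{add}M\rangle$ is an isomorphism for all $s\ge n$. For a subcategory $\mathcal X$ of $\operatorname{mod}A$ put $\phi_r\dim(\mathcal X)=\sup\{\phi_r(X): X\in\mathcal X\}$, and put $\phi_r\dim(A)=\phi_r\dim(\operatorname{mod}A)$. Then, in $\mathbb N\cup\{\infty\}$, $$\phi_r\dim(\mathbb T)\le\max\{\operatorname{gld}\Gamma+1,\ \phi_r\dim(\Lambda/\mathfrak A)+\operatorname{pd}(\Lambda/\mathfrak A)_\Lambda\},$$ where $\phi_r\dim(\mathbb T)$ is computed in $\operatorname{mod}\Lambda$, $\phi_r\dim(\Lambda/\mathfrak A)$ in $\operatorname{mod}\Lambda/\mathfrak A$, $\operatorname{gld}\Gamma$ is the global dimension of $\Gamma$, and $\operatorname{pd}(\Lambda/\mathfrak A)_\Lambda$ is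 the projective dimension of $\Lambda/\mathfrak A$ as a right $\Lambda$-module (the zero module has projective dimension $0$). -/

import Mathlib

universe u v

namespace IgusaTodorov

open CategoryTheory

noncomputable section

section CosyzygyHom

variable (A : Type u) [Ring A]

/-- The defining relations of `K₀`: `[C] = [X] + [Y]` whenever `C ≅ X ⊕ Y`, and `[I] = 0` for
every finitely generated injective module `I`. -/
def k0Relations : Set (FreeAbelianGroup (FGModuleCat.{u} A)) :=
  {x | ∃ X Y C : FGModuleCat.{u} A, Nonempty (C ≃ₗ[A] (X × Y)) ∧
      x = FreeAbelianGroup.of C - (FreeAbelianGroup.of X + FreeAbelianGroup.of Y)} ∪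
  {x | ∃ I : FGModuleCat.{u} A, Module.Injective A I ∧ x = FreeAbelianGroup.of I}

/-- The group `K₀` (the version modulo injectives): generated by the symbols `[M]`, `M` a finitely
generated left `A`-module, modulo direct sums and injectives. -/
abbrev K0 : Type (u + 1) :=
  FreeAbelianGroup (FGModuleCat.{u} A) ⧸ AddSubgroup.closure (k0Relations A)

variable {A}

/-- The class `[M]` of `M` in `K₀`. -/
def cls (M : FGModuleCat.{u} A) : K0 A :=
  QuotientAddGroup.mk' _ (FreeAbelianGroup.of M)

lemma cls_prod {X Y C : FGModuleCat.{u} A} (e : C ≃ₗ[A] (X × Y)) : cls C = cls X + cls Y := by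
  have h : FreeAbelianGroup.of C - (FreeAbelianGroup.of X + FreeAbelianGroup.of Y) ∈
      AddSubgroup.closure (k0Relations A) :=
    AddSubgroup.subset_closure (Or.inl ⟨X, Y, C, ⟨e⟩, rfl⟩)
  have h2 := (QuotientAddGroup.eq_zero_iff _).2 h
  simp only [QuotientAddGroup.mk_sub, QuotientAddGroup.mk_add] at h2
  exact sub_eq_zero.1 h2

lemma cls_injective {I : FGModuleCat.{u} A} (hI : Module.Injective A I) : cls I = 0 :=
  (QuotientAddGroup.eq_zero_iff _).2 (AddSubgroup.subset_closure (Or.inr ⟨I, hI, rfl⟩))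

/-- `Q` is a cosyzygy of `M`: there is a short exact sequence `0 → M → I → Q → 0` with `I` finitely
generated injective. When `M → I` is an injective envelope, `Q` is the minimal cosyzygy
`Ω⁻¹ M`. -/
def IsCosyzygy (M Q : FGModuleCat.{u} A) : Prop :=
  ∃ (I : FGModuleCat.{u} A) (f : M →ₗ[A] I) (p : I →ₗ[A] Q), Module.Injective A I ∧
    Function.Injective f ∧ Function.Exact f p ∧ Function.Surjective p

/-- The dual of Schanuel's lemma. -/
lemma schanuel {M I J Q Q' : Type u} [AddCommGroup M] [AddCommGroup I] [AddCommGroup J]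
    [AddCommGroup Q] [AddCommGroup Q'] [Module A M] [Module A I] [Module A J] [Module A Q]
    [Module A Q'] (hI : Module.Injective A I) (hJ : Module.Injective A J)
    (f : M →ₗ[A] I) (p : I →ₗ[A] Q) (g : M →ₗ[A] J) (q : J →ₗ[A] Q')
    (hf : Function.Injective f) (hfp : Function.Exact f p) (hp : Function.Surjective p)
    (hg : Function.Injective g) (hgq : Function.Exact g q) (hq : Function.Surjective q) :
    Nonempty ((Q × J) ≃ₗ[A] (Q' × I)) := by
  obtain ⟨h, hh⟩ := hJ.out f hf g
  obtain ⟨k, hk⟩ := hI.out g hg f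
  let a : (I × J) →ₗ[A] (Q × J) := p.prodMap LinearMap.id
  let s : (I × J) →ₗ[A] J := LinearMap.snd A I J + h ∘ₗ LinearMap.fst A I J
  let b : (I × J) →ₗ[A] (Q' × I) := (q ∘ₗ s).prod (LinearMap.fst A I J - k ∘ₗ s)
  have ha : Function.Surjective a := by
    rintro ⟨x, y⟩
    obtain ⟨x, rfl⟩ := hp x
    exact ⟨(x, y), rfl⟩
  have hb : Function.Surjective b := by
    rintro ⟨x, y⟩
    obtain ⟨x, rfl⟩ := hq x
    exact ⟨(y + k x, x - h (y + k x)), by simp [b, s]⟩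
  have hker : LinearMap.ker a = LinearMap.ker b := by
    ext ⟨x, y⟩
    constructor
    · intro hx
      have h1 : p x = 0 ∧ y = 0 := by simpa [a] using hx
      obtain ⟨h1, rfl⟩ := h1
      obtain ⟨m, rfl⟩ := (hfp x).1 h1
      have hq0 : q (g m) = 0 := (hgq _).2 ⟨m, rfl⟩
      simp [b, s, hh, hk, hq0]
    · intro hx
      have h1 : q (y + h x) = 0 ∧ x - k (y + h x) = 0 := by simpa [b, s] using hx
      obtain ⟨h1, h2⟩ := h1
      obtain ⟨m, hm⟩ := (hgq _).1 h1
      rw [← hm, hk, sub_eq_zero] at h2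
      subst h2
      rw [hh] at hm
      have hy : y = 0 := by simpa using hm.symm
      have hp0 : p (f m) = 0 := (hfp _).2 ⟨m, rfl⟩
      simp [a, hy, hp0]
  exact ⟨(a.quotKerEquivOfSurjective ha).symm ≪≫ₗ Submodule.quotEquivOfEq _ _ hker ≪≫ₗ
    b.quotKerEquivOfSurjective hb⟩

/-- All cosyzygies of `M` have the same class in `K₀`. -/
lemma cls_cosyzygy_unique {M Q Q' : FGModuleCat.{u} A} (h : IsCosyzygy M Q)
    (h' : IsCosyzygy M Q') : cls Q = cls Q' := by
  obtain ⟨I, f, p, hI, hf, hfp, hp⟩ := h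
  obtain ⟨J, g, q, hJ, hg, hgq, hq⟩ := h'
  obtain ⟨e⟩ := schanuel hI hJ f p g q hf hfp hp hg hgq hq
  have h1 : cls (FGModuleCat.of A (Q × J)) = cls Q + cls J := cls_prod (LinearEquiv.refl A _)
  have h2 : cls (FGModuleCat.of A (Q × J)) = cls Q' + cls I := cls_prod e
  rw [cls_injective hJ, add_zero] at h1
  rw [cls_injective hI, add_zero] at h2
  exact h1.symm.trans h2

lemma injective_prod {I J : Type u} [AddCommGroup I] [AddCommGroup J] [Module A I] [Module A J]
    (hI : Module.Injective A I) (hJ : Module.Injective A J) : Module.Injective A (I × J) := by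
  refine ⟨fun X Y _ _ _ _ f hf g => ?_⟩
  obtain ⟨a, ha⟩ := hI.out f hf (LinearMap.fst A I J ∘ₗ g)
  obtain ⟨b, hb⟩ := hJ.out f hf (LinearMap.snd A I J ∘ₗ g)
  exact ⟨a.prod b, fun x => Prod.ext (by simpa using ha x) (by simpa using hb x)⟩

lemma isCosyzygy_prod {X Y C Q Q' : FGModuleCat.{u} A} (e : C ≃ₗ[A] (X × Y))
    (h : IsCosyzygy X Q) (h' : IsCosyzygy Y Q') :
    IsCosyzygy C (FGModuleCat.of A (Q × Q')) := by
  obtain ⟨I, f, p, hI, hf, hfp, hp⟩ := h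
  obtain ⟨J, g, q, hJ, hg, hgq, hq⟩ := h'
  have hinj : Function.Injective (f.prodMap g) := Prod.map_injective.2 ⟨hf, hg⟩
  have hsurj : Function.Surjective (p.prodMap q) := Prod.map_surjective.2 ⟨hp, hq⟩
  have hex : Function.Exact ((f.prodMap g) ∘ₗ e.toLinearMap) (p.prodMap q) := by
    rintro ⟨x, y⟩
    constructor
    · intro hxy
      have h1 : p x = 0 ∧ q y = 0 := by simpa using hxy
      obtain ⟨m, rfl⟩ := (hfp x).1 h1.1
      obtain ⟨n, rfl⟩ := (hgq y).1 h1.2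
      exact ⟨e.symm (m, n), by simp⟩
    · rintro ⟨c, hc⟩
      have h1 : f (e c).1 = x ∧ g (e c).2 = y := by simpa using hc
      have h2 : p x = 0 := (hfp x).2 ⟨_, h1.1⟩
      have h3 : q y = 0 := (hgq y).2 ⟨_, h1.2⟩
      simp [h2, h3]
  exact ⟨FGModuleCat.of A (I × J), (f.prodMap g) ∘ₗ e.toLinearMap, p.prodMap q,
    injective_prod hI hJ, hinj.comp e.injective, hex, hsurj⟩

lemma cls_cosyzygy_injective {I Q : FGModuleCat.{u} A} (hI : Module.Injective A I)
    (h : IsCosyzygy I Q) : cls Q = 0 := by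
  have h0 : IsCosyzygy I (FGModuleCat.of A PUnit.{u + 1}) :=
    ⟨I, LinearMap.id, 0, hI, Function.injective_id, fun x => by simp, fun x => ⟨0, rfl⟩⟩
  have h1 : Module.Injective A (FGModuleCat.of A PUnit.{u + 1}) :=
    ⟨fun _ _ _ _ _ _ _ _ _ => ⟨0, fun _ => rfl⟩⟩
  rw [cls_cosyzygy_unique h h0, cls_injective h1]

variable (A) in
/-- Every finitely generated module embeds into a finitely generated injective one. Every artin
algebra has this property. -/
def HasCosyzygies : Prop :=
  ∀ M : FGModuleCat.{u} A, ∃ Q, IsCosyzygy M Q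

/-- The homomorphism `K₀ → K₀`, `[M] ↦ [Ω⁻¹ M]`, over a ring with `HasCosyzygies A`. -/
def cosyzygyHomOf (h : HasCosyzygies A) : K0 A →+ K0 A :=
  QuotientAddGroup.lift (AddSubgroup.closure (k0Relations A))
    (FreeAbelianGroup.lift fun M => cls (h M).choose) (by
      rw [AddSubgroup.closure_le]
      rintro x (⟨X, Y, C, ⟨e⟩, rfl⟩ | ⟨I, hI, rfl⟩)
      · change FreeAbelianGroup.lift (fun M => cls (h M).choose) _ = 0
        rw [map_sub, map_add]
        simp only [FreeAbelianGroup.lift_apply_of]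
        rw [sub_eq_zero, cls_cosyzygy_unique (h C).choose_spec
          (isCosyzygy_prod e (h X).choose_spec (h Y).choose_spec)]
        exact cls_prod (LinearEquiv.refl A _)
      · change FreeAbelianGroup.lift (fun M => cls (h M).choose) _ = 0
        simp only [FreeAbelianGroup.lift_apply_of]
        exact cls_cosyzygy_injective hI (h I).choose_spec)

variable (A) in
open Classical in
/-- The homomorphism `K₀ → K₀` induced by the cosyzygy, `[M] ↦ [Ω⁻¹ M]`; the value `0` in the second
branch is never used for artin algebras. -/
def cosyzygyHom : K0 A →+ K0 A :=
  if h : HasCosyzygies A then cosyzygyHomOf h else 0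

/-- Over a ring with cosyzygies, `cosyzygyHom` sends `[M]` to the class of any cosyzygy of `M`, in
particular of the cokernel of an injective envelope of `M`. -/
lemma cosyzygyHom_cls (h : HasCosyzygies A) {M Q : FGModuleCat.{u} A} (hQ : IsCosyzygy M Q) :
    cosyzygyHom A (cls M) = cls Q := by
  rw [cosyzygyHom, dif_pos h]
  have h1 : cosyzygyHomOf h (cls M) = cls (h M).choose := by
    change FreeAbelianGroup.lift (fun M => cls (h M).choose) (FreeAbelianGroup.of M) = _
    simp only [FreeAbelianGroup.lift_apply_of]
  rw [h1]
  exact cls_cosyzygy_unique (h M).choose_spec hQ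

end CosyzygyHom

section Phi

variable {A : Type u} [Ring A]

def IsDirectSummand (N M : FGModuleCat.{u} A) : Prop :=
  ∃ N' : FGModuleCat.{u} A, Nonempty (M ≃ₗ[A] (N × N'))

def IsIndecomposable (N : FGModuleCat.{u} A) : Prop :=
  Nontrivial N ∧ ∀ X Y : FGModuleCat.{u} A, Nonempty (N ≃ₗ[A] (X × Y)) →
    Subsingleton X ∨ Subsingleton Y

/-- The subgroup `⟨add M⟩` of `K₀` generated by the indecomposable direct summands of `M`. -/
def addSpan (M : FGModuleCat.{u} A) : AddSubgroup (K0 A) :=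
  AddSubgroup.closure {x | ∃ N, IsDirectSummand N M ∧ IsIndecomposable N ∧ x = cls N}

/-- The subgroup `Ω⁻ˢ⟨add M⟩` of `K₀`. -/
def cosyzygySpan (M : FGModuleCat.{u} A) : ℕ → AddSubgroup (K0 A)
  | 0 => addSpan M
  | s + 1 => (cosyzygySpan M s).map (cosyzygyHom A)

/-- `φ_r(M)`: the least `n` such that the cosyzygy homomorphism
`Ω⁻ˢ⟨add M⟩ → Ω⁻⁽ˢ⁺¹⁾⟨add M⟩` is an isomorphism for all `s ≥ n`. -/
def phiR (M : FGModuleCat.{u} A) : ℕ∞ :=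
  ⨅ n ∈ {n : ℕ | ∀ s : ℕ, n ≤ s →
    Set.BijOn (cosyzygyHom A) (cosyzygySpan M s) (cosyzygySpan M (s + 1))}, (n : ℕ∞)

/-- `φ_r dim 𝒳 = sup {φ_r(X) : X ∈ 𝒳}` for a class `𝒳` of finitely generated modules. -/
def phiRDimOn (𝒳 : Set (FGModuleCat.{u} A)) : ℕ∞ :=
  ⨆ X ∈ 𝒳, phiR X

variable (A) in
/-- `φ_r dim A`. -/
def phiRDim : ℕ∞ := phiRDimOn (Set.univ : Set (FGModuleCat.{u} A))

end Phi

section Dimensions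

/-- The projective dimension, with the zero module having projective dimension `0`. -/
def pdim {A : Type u} [Ring A] (M : ModuleCat.{u} A) : ℕ∞ :=
  (projectiveDimension M).unbotD 0

/-- The (left) global dimension. -/
def gldim (A : Type u) [Ring A] : ℕ∞ :=
  ⨆ M : ModuleCat.{u} A, pdim M

end Dimensions

section IdempotentIdeal

variable {Λ : Type u} [Ring Λ] (I : Ideal Λ) [I.IsTwoSided]

instance {A B : Type u} [Ring A] [Ring B] (f : A →+* B) :
    Limits.PreservesFiniteLimits (ModuleCat.restrictScalars.{u} f) where
  preservesFiniteLimits _ _ _ := ⟨inferInstance⟩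

instance {A B : Type u} [Ring A] [Ring B] (f : A →+* B) :
    Limits.PreservesFiniteColimits (ModuleCat.restrictScalars.{u} f) where
  preservesFiniteColimits _ _ _ := ⟨inferInstance⟩

/-- `I` is a strong idempotent ideal: `I` is an idempotent ideal and the canonical maps
`Ext^i_{Λ/I}(X, Y) → Ext^i_Λ(X, Y)`, induced by the exact inclusion of `Λ/I`-modules into
`Λ`-modules, are bijective for all `i ≥ 0` and all finitely generated `Λ/I`-modules `X`, `Y`. -/
def IsStrongIdempotent : Prop :=
  IsIdempotentElem I ∧
  ∀ (i : ℕ) (X Y : ModuleCat.{u} (Λ ⧸ I)), Module.Finite (Λ ⧸ I) X → Module.Finite (Λ ⧸ I) Y →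
    Function.Bijective (fun x : Abelian.Ext X Y i =>
      x.mapExactFunctor (ModuleCat.restrictScalars (Ideal.Quotient.mk I)))

/-- The subcategory `𝕋` of the finitely generated `Λ`-modules `T` with
`Ext^i_Λ(Λ/I, T) = 0` for all `i ≥ 1`. -/
def subcatT : Set (FGModuleCat.{u} Λ) :=
  {T | ∀ i : ℕ, 1 ≤ i → Subsingleton (Abelian.Ext (ModuleCat.of Λ (Λ ⧸ I)) T.obj i)}

/-- `Λ/I` as a right `Λ`-module, that is, as a module over the opposite ring. -/
def rightQuotient : ModuleCat.{u} Λᵐᵒᵖ :=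
  (ModuleCat.restrictScalars (RingHom.op (Ideal.Quotient.mk I))).obj
    (ModuleCat.of (Λ ⧸ I)ᵐᵒᵖ (Λ ⧸ I))

/-- The algebra `Γ = End_Λ(P)ᵒᵖ` for the projective left module `P = Λe`. -/
abbrev cornerAlgebra (e : Λ) : Type u :=
  (Module.End Λ (Ideal.span ({e} : Set Λ)))ᵐᵒᵖ

end IdempotentIdeal

end

end IgusaTodorov

/-! Write B = Λ/𝔄, g = gld Γ, d = pd of B as a right Λ-module, m = φ_r dim B; if one of these is
infinite there is nothing to prove. The plan is to compare Ω⁻¹ on K₀(Λ) with Ω⁻¹ on K₀(B) by two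
homomorphisms that nearly invert each other. Going down, `annihilatedHom` is induced by Hom_Λ(B, -),
the largest submodule killed by 𝔄. It preserves injectives, and Ext¹(B, T) = 0 makes it exact on
cosyzygy sequences of modules in 𝕋, so it commutes with Ω⁻¹ on the classes coming from 𝕋
(`annihilatedHom_cosyzygyHom`). Going up, restriction of scalars does not preserve injectives, but
an injective B-module has injective dimension at most d over Λ: it is a summand of a product of
character duals of B_Λ. Composing with Ω⁻ᵈ therefore gives a well-defined map `restrictHom`, and it
commutes with Ω⁻¹ (`restrictHom_cosyzygyHom`). For T in 𝕋 let T' be its largest submodule killed by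
𝔄, and Y = T/T'. Since 𝔄 is a strong idempotent ideal, Extⁱ(B, Y) = 0 for all i ≥ 0. Such a Y has
injective dimension at most that of eY over Γ, hence at most g
(`hasInjectiveDimensionLT_of_corner`): it embeds into a module coinduced from an injective Γ-module,
and the cokernel has the same vanishing. So T' and T have the same iterated cosyzygy class from step
g + 1 on, and going down and up again amounts to Ω⁻ᵈ after enough further cosyzygies
(`iterate_restrictHom_annihilatedHom`). Now let s ≥ max(g + 1, m + d), s = k + d, and let x in ⟨add
T⟩ satisfy Ω⁻⁽ˢ⁺¹⁾x = 0. Its image in K₀(B) lies in ⟨add T'⟩ and is killed by Ω⁻⁽ˢ⁺¹⁾, hence already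
by Ω⁻ᵏ because k ≥ m. Going up yields Ω⁻ˢx = 0, which is the injectivity required for φ_r(T) ≤ max(g
+ 1, m + d). -/

namespace IgusaTodorov

open CategoryTheory

/-! ### Injective hulls. -/

section InjectiveHull

variable {A : Type u} [Ring A]

/-- Every submodule disjoint from `C` is contained in a maximal such one. -/
lemma exists_maximal_disjoint {Q : Type u} [AddCommGroup Q] [Module A Q] (S C : Submodule A Q)
    (h : Disjoint S C) : ∃ E, S ≤ E ∧ Disjoint E C ∧ ∀ N, E ≤ N → Disjoint N C → N = E := by
  obtain ⟨E, hSE, hE⟩ := zorn_le_nonempty₀ {N : Submodule A Q | Disjoint N C}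
    (fun c hc hchain y hy => ⟨sSup c, (hchain.directedOn.disjoint_sSup_left).2
      fun N hN => hc hN, fun z hz => le_sSup hz⟩) S h
  exact ⟨E, hSE, hE.prop, fun N h1 h2 => (hE.eq_of_le h2 h1).symm⟩

lemma injective_of_retract {E Q : Type u} [AddCommGroup E] [Module A E] [AddCommGroup Q]
    [Module A Q] (hQ : Module.Injective A Q) (i : E →ₗ[A] Q) (r : Q →ₗ[A] E)
    (h : ∀ x, r (i x) = x) : Module.Injective A E := by
  refine ⟨fun X Y _ _ _ _ f hf g => ?_⟩
  obtain ⟨k, hk⟩ := hQ.out f hf (i ∘ₗ g)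
  exact ⟨r ∘ₗ k, fun x => by simp [hk, h]⟩

/-- Every module embeds into an injective module. -/
lemma exists_injective_embedding (M : Type u) [AddCommGroup M] [Module A M] :
    ∃ (Q : ModuleCat.{u} A) (f : M →ₗ[A] Q), Module.Injective A Q ∧ Function.Injective f :=
  ⟨Injective.under (ModuleCat.of A M), (Injective.ι (ModuleCat.of A M)).hom,
    (Module.injective_iff_injective_object A _).2
      (inferInstanceAs (Injective (Injective.under (ModuleCat.of A M)))),
    (ModuleCat.mono_iff_injective _).1 inferInstance⟩

/-- Every module has an injective hull. -/
lemma exists_injective_hull (M : Type u) [AddCommGroup M] [Module A M] :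
    ∃ (E : ModuleCat.{u} A) (f : M →ₗ[A] E), Module.Injective A E ∧ Function.Injective f ∧
      ∀ N : Submodule A E, Disjoint N (LinearMap.range f) → N = ⊥ := by
  obtain ⟨Q, f, hQ, hf⟩ := exists_injective_embedding (A := A) M
  -- The hull is found inside `Q`: `C` is a maximal complement of `M`, and `E` a maximal complement
  -- of `C` containing `M`. Extending the projection `E ⊕ C → E` to an endomorphism `θ` of `Q` will
  -- exhibit `E` as a retract.
  obtain ⟨C, -, hCM, hCmax⟩ := exists_maximal_disjoint ⊥ (LinearMap.range f) disjoint_bot_left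
  obtain ⟨E, hME, hEC, hEmax⟩ := exists_maximal_disjoint (LinearMap.range f) C hCM.symm
  obtain ⟨θ, hθ⟩ := hQ.out (E.subtype.coprod C.subtype) (by
    rw [← LinearMap.ker_eq_bot, LinearMap.ker_coprod_of_disjoint_range _ _ (by simpa using hEC)]
    simp) (E.subtype ∘ₗ LinearMap.fst A E C)
  have hθE : ∀ x ∈ E, θ x = x := fun x hx => by simpa using hθ (⟨x, hx⟩, 0)
  have hθC : ∀ x ∈ C, θ x = 0 := fun x hx => by simpa using hθ (0, ⟨x, hx⟩)
  -- As `θ` fixes `M`, the preimage of `C` still misses `M`, so it is `C` by maximality. Hence the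
  -- range of `θ` misses `C`, and maximality of `E` makes that range equal to `E`.
  have hcomap : C.comap θ = C := by
    refine hCmax _ (fun x hx => by simp [hθC x hx]) ?_
    rw [Submodule.disjoint_def]
    intro x hx hxM
    rw [Submodule.mem_comap, hθE x (hME hxM)] at hx
    exact Submodule.disjoint_def.1 hCM x hx hxM
  have hrange : LinearMap.range θ = E := by
    refine hEmax _ (fun x hx => ⟨x, hθE x hx⟩) ?_
    rw [Submodule.disjoint_def]
    rintro _ ⟨x, rfl⟩ hx
    exact hθC x (hcomap ▸ hx)
  have hθmem : ∀ x, θ x ∈ E := fun x => hrange ▸ ⟨x, rfl⟩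
  refine ⟨ModuleCat.of A E, f.codRestrict E fun x => hME ⟨x, rfl⟩,
    injective_of_retract hQ E.subtype (θ.codRestrict E hθmem) (fun x => Subtype.ext ?_),
    fun x y hxy => hf (congrArg Subtype.val hxy), fun N hN => ?_⟩
  · simpa using hθE x x.2
  -- Essentiality: `N + C` still misses `M`, so maximality of `C` forces `N ≤ C`, while `N ≤ E`.
  · have hN' : Disjoint (N.map E.subtype ⊔ C) (LinearMap.range f) := by
      rw [Submodule.disjoint_def]
      rintro _ hx ⟨m, rfl⟩
      obtain ⟨_, ⟨n, hn, rfl⟩, c, hc, h⟩ := Submodule.mem_sup.1 hx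
      have hcE : c ∈ E := by
        rw [← eq_sub_iff_add_eq'] at h
        rw [h]
        exact E.sub_mem (hME ⟨m, rfl⟩) n.2
      have hc0 := Submodule.disjoint_def.1 hEC c hcE hc
      rw [hc0, add_zero] at h
      have hnm : n = f.codRestrict E (fun x => hME ⟨x, rfl⟩) m := Subtype.ext h
      have := Submodule.disjoint_def.1 hN n hn ⟨m, hnm.symm⟩
      rw [← h, this]
      simp
    have hle := hCmax _ le_sup_right hN'
    rw [eq_bot_iff]
    intro n hn
    have hnC : (n : Q) ∈ C := hle ▸ Submodule.mem_sup_left ⟨n, hn, rfl⟩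
    exact Subtype.ext (Submodule.disjoint_def.1 hEC _ n.2 hnC)

end InjectiveHull

section Annihilated

variable {A : Type u} [Ring A] (I : Ideal A) [I.IsTwoSided]

/-- The submodule of the elements annihilated by a two-sided ideal. -/
def annihilated (M : Type*) [AddCommGroup M] [Module A M] : Submodule A M where
  carrier := {x | ∀ a ∈ I, a • x = 0}
  add_mem' hx hy a ha := by rw [smul_add, hx a ha, hy a ha, add_zero]
  zero_mem' a _ := smul_zero a
  smul_mem' c x hx a ha := by rw [smul_smul]; exact hx _ (I.mul_mem_right c ha)

lemma annihilated_isTorsionBySet (M : Type*) [AddCommGroup M] [Module A M] :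
    Module.IsTorsionBySet A (annihilated I M) I :=
  fun x a => Subtype.ext (x.2 a a.2)

end Annihilated

/-! ### Finitely generated cosyzygies over an artin algebra. -/

section Artin

variable (R : Type v) {A : Type u} [CommRing R] [IsArtinianRing R] [Ring A] [Algebra R A]
  [Module.Finite R A]

include R in
/-- An essential extension of a finitely generated module over an artin algebra is finitely
generated. -/
lemma finite_of_essential {M E : Type u} [AddCommGroup M] [Module A M] [Module.Finite A M]
    [AddCommGroup E] [Module A E] (f : M →ₗ[A] E)
    (hf : ∀ N : Submodule A E, Disjoint N (LinearMap.range f) → N = ⊥) : Module.Finite A E := by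
  let _ : Module R E := Module.compHom E (algebraMap R A)
  have : IsScalarTower R A E := ⟨fun r a x => by
    rw [Algebra.smul_def, mul_smul]; rfl⟩
  have : IsArtinianRing A := IsArtinianRing.of_finite R A
  set J := Ring.jacobson A
  -- The part killed by the radical is semisimple, so its intersection with `M` has a complement
  -- there; that complement misses `M` and vanishes by essentiality.
  have hsub : annihilated J E ≤ LinearMap.range f := by
    have hss : IsSemisimpleModule A (annihilated J E) := by
      let _ := (annihilated_isTorsionBySet J E).module
      exact (annihilated_isTorsionBySet J E).isSemisimpleModule_iff.1 inferInstance
    obtain ⟨N, hN⟩ := exists_isCompl ((LinearMap.range f).comap (annihilated J E).subtype)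
    have h0 : N.map (annihilated J E).subtype = ⊥ := by
      refine hf _ ?_
      rw [Submodule.disjoint_def]
      rintro _ ⟨n, hn, rfl⟩ hx
      have := Submodule.disjoint_def.1 hN.disjoint n hx hn
      simp [this]
    have hN0 : N = ⊥ := Submodule.map_injective_of_injective
      (Submodule.injective_subtype _) (h0.trans (Submodule.map_bot _).symm)
    have htop := hN.sup_eq_top
    rw [hN0, sup_bot_eq] at htop
    intro x hx
    have : (⟨x, hx⟩ : annihilated J E) ∈ (LinearMap.range f).comap (annihilated J E).subtype := by
      rw [htop]; trivial
    exact this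
  obtain ⟨k, a, ha⟩ := Submodule.fg_iff_exists_fin_generating_family.1
    (IsNoetherian.noetherian J)
  have hpow : ∀ n : ℕ, IsNoetherian R (annihilated (J ^ n) E) := by
    intro n
    induction n with
    | zero =>
      have : Subsingleton (annihilated (J ^ 0) E) := ⟨fun x y => Subtype.ext (by
        have hx := x.2 1 (by rw [J.pow_zero, Ideal.one_eq_top]; trivial)
        have hy := y.2 1 (by rw [J.pow_zero, Ideal.one_eq_top]; trivial)
        rw [one_smul] at hx hy
        rw [hx, hy])⟩
      infer_instance
    | succ n ih =>
      -- With `a i` generating `J` as a left ideal, the kernel of `x ↦ (a i • x)` is killed by `J`,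
      -- so it lies in `M`. Multiplication by `a i` is only `R`-linear, which is why the induction
      -- is about Noetherian `R`-modules.
      let g : annihilated (J ^ (n + 1)) E →ₗ[R] (Fin k → annihilated (J ^ n) E) :=
        { toFun := fun x i => ⟨a i • (x : E), fun b hb => by
            rw [smul_smul]
            refine x.2 _ ?_
            rw [J.pow_succ]
            exact Ideal.mul_mem_mul hb (ha ▸ Submodule.subset_span ⟨i, rfl⟩)⟩
          map_add' := fun x y => by
            ext i
            simp
          map_smul' := fun r x => by
            ext i
            simp only [Submodule.coe_smul_of_tower, Pi.smul_apply, RingHom.id_apply]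
            exact smul_comm _ _ _ }
      have hker : ∀ x ∈ LinearMap.ker g, (x : E) ∈ LinearMap.range f := by
        intro x hx
        refine hsub fun b hb => ?_
        rw [← ha] at hb
        induction hb using Submodule.span_induction with
        | mem b hb =>
          obtain ⟨i, rfl⟩ := hb
          exact congrArg Subtype.val (congrFun (LinearMap.mem_ker.1 hx) i)
        | zero => simp
        | add b c _ _ h1 h2 => rw [add_smul, h1, h2, add_zero]
        | smul r b _ h => rw [smul_eq_mul, mul_smul, h, smul_zero]
      have hrange : IsNoetherian R (LinearMap.range (f.restrictScalars A)) := by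
        have : Module.Finite A (LinearMap.range f) := inferInstance
        have : Module.Finite R (LinearMap.range f) := Module.Finite.trans A _
        exact isNoetherian_of_isNoetherianRing_of_finite R (LinearMap.range f)
      have hkerN : IsNoetherian R (LinearMap.ker g) := by
        let h : LinearMap.ker g →ₗ[R] LinearMap.range f :=
          { toFun := fun x => ⟨x.1, hker x.1 x.2⟩
            map_add' := fun _ _ => rfl
            map_smul' := fun _ _ => rfl }
        have : IsNoetherian R (LinearMap.range f) := hrange
        exact isNoetherian_of_injective h fun x y hxy =>
          Subtype.ext (Subtype.ext (Subtype.ext_iff.1 (show h x = h y from hxy) :))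
      exact isNoetherian_of_range_eq_ker (LinearMap.ker g).subtype g (by simp)
  obtain ⟨n, hn⟩ := IsSemiprimaryRing.isNilpotent (R := A)
  have := hpow n
  have htop : annihilated (J ^ n) E = ⊤ := by
    rw [eq_top_iff]
    intro x _ b hb
    rw [show J ^ n = 0 from hn] at hb
    rw [show b = 0 from hb, zero_smul]
  rw [htop] at this
  have : Module.Finite R (⊤ : Submodule A E) := inferInstance
  have : Module.Finite A (⊤ : Submodule A E) := Module.Finite.of_restrictScalars_finite R A _
  exact Module.Finite.equiv (Submodule.topEquiv (R := A) (M := E))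

variable (A) in
include R in
/-- Over an artin algebra, every finitely generated module has a finitely generated cosyzygy. -/
lemma hasCosyzygies : HasCosyzygies A := by
  intro M
  obtain ⟨E, f, hE, hf, hess⟩ := exists_injective_hull (A := A) M
  have : Module.Finite A E := finite_of_essential R f hess
  exact ⟨FGModuleCat.of A (E ⧸ LinearMap.range f), FGModuleCat.of A E, f,
    (LinearMap.range f).mkQ, hE, hf, LinearMap.exact_map_mkQ_range f,
    Submodule.mkQ_surjective _⟩

end Artin

/-! ### Vanishing of Ext under exact sequences and retracts. -/

section Ext

variable {A : Type u} [Ring A]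

lemma shortExact_of_exact {M N K : Type u} [AddCommGroup M] [AddCommGroup N] [AddCommGroup K]
    [Module A M] [Module A N] [Module A K] (f : M →ₗ[A] N) (g : N →ₗ[A] K)
    (hf : Function.Injective f) (hfg : Function.Exact f g) (hg : Function.Surjective g) :
    (ShortComplex.mk (ModuleCat.ofHom f) (ModuleCat.ofHom g)
      (ModuleCat.hom_ext hfg.linearMap_comp_eq_zero)).ShortExact where
  exact := (ShortComplex.ShortExact.moduleCat_exact_iff_function_exact _).2 hfg
  mono_f := (ModuleCat.mono_iff_injective _).2 hf
  epi_g := (ModuleCat.epi_iff_surjective _).2 hg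

lemma subsingleton_ext_of_exact {M N K : Type u} [AddCommGroup M] [AddCommGroup N]
    [AddCommGroup K] [Module A M] [Module A N] [Module A K] (f : M →ₗ[A] N) (g : N →ₗ[A] K)
    (hf : Function.Injective f) (hfg : Function.Exact f g) (hg : Function.Surjective g)
    (X : ModuleCat.{u} A) (i : ℕ) (hN : Subsingleton (Abelian.Ext X (ModuleCat.of A N) i))
    (hM : Subsingleton (Abelian.Ext X (ModuleCat.of A M) (i + 1))) :
    Subsingleton (Abelian.Ext X (ModuleCat.of A K) i) := by
  refine subsingleton_of_forall_eq 0 fun x => ?_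
  obtain ⟨y, rfl⟩ := Abelian.Ext.covariant_sequence_exact₃ X
    (shortExact_of_exact f g hf hfg hg) x rfl (Subsingleton.elim (α := Abelian.Ext _ _ _) _ _)
  rw [Subsingleton.elim (α := Abelian.Ext X (ModuleCat.of A N) i) y 0, Abelian.Ext.zero_comp]

lemma subsingleton_ext_of_injective (X : ModuleCat.{u} A) {J : Type u} [AddCommGroup J]
    [Module A J] (hJ : Module.Injective A J) (i : ℕ) (hi : 1 ≤ i) :
    Subsingleton (Abelian.Ext X (ModuleCat.of A J) i) := by
  have : Injective (ModuleCat.of A J) := (Module.injective_iff_injective_object A J).1 hJ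
  exact HasInjectiveDimensionLT.subsingleton _ 1 i hi X

lemma subsingleton_ext_of_retract (X : ModuleCat.{u} A) {M N : ModuleCat.{u} A} (f : M →ₗ[A] N)
    (r : N →ₗ[A] M) (h : ∀ x, r (f x) = x) (i : ℕ) (hN : Subsingleton (Abelian.Ext X N i)) :
    Subsingleton (Abelian.Ext X M i) := by
  refine subsingleton_of_forall_eq 0 fun x => ?_
  have hid : ModuleCat.ofHom f ≫ ModuleCat.ofHom r = 𝟙 M :=
    ModuleCat.hom_ext (LinearMap.ext h)
  rw [← Abelian.Ext.comp_mk₀_id x, ← hid, ← Abelian.Ext.mk₀_comp_mk₀,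
    ← Abelian.Ext.comp_assoc_of_third_deg_zero,
    Subsingleton.elim (x.comp (Abelian.Ext.mk₀ (ModuleCat.ofHom f)) (add_zero i)) 0,
    Abelian.Ext.zero_comp]

lemma subsingleton_ext_of_retract_left {M N : ModuleCat.{u} A} (X : ModuleCat.{u} A)
    (f : M →ₗ[A] N) (r : N →ₗ[A] M) (h : ∀ x, r (f x) = x) (i : ℕ)
    (hN : Subsingleton (Abelian.Ext N X i)) :
    Subsingleton (Abelian.Ext M X i) := by
  refine subsingleton_of_forall_eq 0 fun x => ?_
  have hid : ModuleCat.ofHom f ≫ ModuleCat.ofHom r = 𝟙 M :=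
    ModuleCat.hom_ext (LinearMap.ext h)
  rw [← Abelian.Ext.mk₀_id_comp x, ← hid, ← Abelian.Ext.mk₀_comp_mk₀,
    Abelian.Ext.comp_assoc_of_second_deg_zero,
    Subsingleton.elim ((Abelian.Ext.mk₀ (ModuleCat.ofHom r)).comp x (zero_add i)) 0,
    Abelian.Ext.comp_zero]

/-- If `Ext¹(A/I, M) = 0`, then every homomorphism `I → M` extends to `A`. -/
lemma exists_smul_eq_of_ext_one (I : Ideal A) {M : Type u} [AddCommGroup M] [Module A M]
    (h : Subsingleton (Abelian.Ext (ModuleCat.of A (A ⧸ I)) (ModuleCat.of A M) 1))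
    (g : I →ₗ[A] M) : ∃ m, ∀ a : I, g a = (a : A) • m := by
  obtain ⟨y, hy⟩ := Abelian.Ext.contravariant_sequence_exact₁
    (shortExact_of_exact I.subtype I.mkQ (Submodule.injective_subtype _)
      (LinearMap.exact_subtype_mkQ I) (Submodule.mkQ_surjective _)) (ModuleCat.of A M)
    (Abelian.Ext.mk₀ (ModuleCat.ofHom g)) rfl (Subsingleton.elim (α := Abelian.Ext _ _ _) _ _)
  obtain ⟨k, rfl⟩ := (Abelian.Ext.mk₀_bijective _ _).2 y
  rw [Abelian.Ext.mk₀_comp_mk₀] at hy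
  have hk := (Abelian.Ext.mk₀_bijective _ _).1 hy
  have hk' : k.hom ∘ₗ I.subtype = g := congrArg ModuleCat.Hom.hom hk
  refine ⟨k.hom 1, fun a => ?_⟩
  rw [← hk', ← map_smul]
  simp

end Ext

/-! ### Strong idempotent ideals and the subcategory 𝕋. -/

section StrongIdempotent

variable {Λ : Type u} [Ring Λ] (I : Ideal Λ) [I.IsTwoSided]

instance annihilatedModule (M : Type*) [AddCommGroup M] [Module Λ M] :
    Module (Λ ⧸ I) (annihilated I M) :=
  (annihilated_isTorsionBySet I M).module

/-- Strongness identifies this group with an Ext over `Λ ⧸ I`, where the first argument is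
projective. -/
lemma subsingleton_ext_restrictScalars (h : IsStrongIdempotent I) (X : ModuleCat.{u} (Λ ⧸ I))
    (hX : Module.Finite (Λ ⧸ I) X) (i : ℕ) (hi : 1 ≤ i) :
    Subsingleton (Abelian.Ext (ModuleCat.of Λ (Λ ⧸ I))
      ((ModuleCat.restrictScalars (Ideal.Quotient.mk I)).obj X) i) := by
  have hproj : Projective (ModuleCat.of (Λ ⧸ I) (Λ ⧸ I)) :=
    (IsProjective.iff_projective (R := Λ ⧸ I) (Λ ⧸ I)).1 inferInstance
  have h0 : Subsingleton (Abelian.Ext (ModuleCat.of (Λ ⧸ I) (Λ ⧸ I)) X i) :=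
    HasProjectiveDimensionLT.subsingleton _ 1 i hi X
  have h1 := (h.2 i (ModuleCat.of (Λ ⧸ I) (Λ ⧸ I)) X
    (inferInstanceAs (Module.Finite (Λ ⧸ I) (Λ ⧸ I))) hX).2.subsingleton
  -- The identity map, in both directions, between two presentations of the same `Λ`-module: the
  -- quotient structure on `Λ ⧸ I` and the one restricted along `Λ → Λ ⧸ I`.
  let f : Λ ⧸ I →ₗ[Λ] (ModuleCat.restrictScalars (Ideal.Quotient.mk I)).obj
      (ModuleCat.of (Λ ⧸ I) (Λ ⧸ I)) :=
    { toFun := fun x => x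
      map_add' := fun _ _ => rfl
      map_smul' := fun a x => by
        obtain ⟨x, rfl⟩ := Ideal.Quotient.mk_surjective x
        rfl }
  let r : (ModuleCat.restrictScalars (Ideal.Quotient.mk I)).obj
      (ModuleCat.of (Λ ⧸ I) (Λ ⧸ I)) →ₗ[Λ] Λ ⧸ I :=
    { toFun := fun x => x
      map_add' := fun _ _ => rfl
      map_smul' := fun a x => (f.map_smul a x).symm }
  exact subsingleton_ext_of_retract_left (M := ModuleCat.of Λ (Λ ⧸ I)) _ f r (fun _ => rfl) i h1

instance annihilated_finite [IsNoetherianRing Λ] (M : Type*) [AddCommGroup M] [Module Λ M]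
    [Module.Finite Λ M] : Module.Finite (Λ ⧸ I) (annihilated I M) := by
  obtain ⟨s, hs⟩ := (inferInstance : Module.Finite Λ (annihilated I M))
  refine ⟨s, eq_top_iff.2 fun x _ => ?_⟩
  have hx : x ∈ Submodule.span Λ (s : Set (annihilated I M)) := hs ▸ trivial
  induction hx using Submodule.span_induction with
  | mem x hx => exact Submodule.subset_span hx
  | zero => exact Submodule.zero_mem _
  | add x y _ _ h1 h2 => exact Submodule.add_mem _ (h1 trivial) (h2 trivial)
  | smul a x _ h1 => exact Submodule.smul_mem _ (Ideal.Quotient.mk I a) (h1 trivial)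

lemma subsingleton_ext_annihilated [IsNoetherianRing Λ] (h : IsStrongIdempotent I)
    (M : Type u) [AddCommGroup M] [Module Λ M] [Module.Finite Λ M] (i : ℕ) (hi : 1 ≤ i) :
    Subsingleton (Abelian.Ext (ModuleCat.of Λ (Λ ⧸ I)) (ModuleCat.of Λ (annihilated I M)) i) := by
  let f : annihilated I M →ₗ[Λ] (ModuleCat.restrictScalars (Ideal.Quotient.mk I)).obj
      (ModuleCat.of (Λ ⧸ I) (annihilated I M)) :=
    { toFun := fun x => x
      map_add' := fun _ _ => rfl
      map_smul' := fun _ _ => rfl }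
  let r : (ModuleCat.restrictScalars (Ideal.Quotient.mk I)).obj
      (ModuleCat.of (Λ ⧸ I) (annihilated I M)) →ₗ[Λ] annihilated I M :=
    { toFun := fun x => x
      map_add' := fun _ _ => rfl
      map_smul' := fun _ _ => rfl }
  exact subsingleton_ext_of_retract (M := ModuleCat.of Λ (annihilated I M)) _ f r (fun _ => rfl) i
    (subsingleton_ext_restrictScalars I h (ModuleCat.of (Λ ⧸ I) (annihilated I M))
      inferInstance i hi)

/-- If `I` is idempotent, then the quotient of `M` by the elements annihilated by `I` has no
nonzero element annihilated by `I`. -/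
lemma annihilated_quotient_eq_bot (h : IsIdempotentElem I) (M : Type*) [AddCommGroup M]
    [Module Λ M] : annihilated I (M ⧸ annihilated I M) = ⊥ := by
  rw [eq_bot_iff]
  intro x hx
  obtain ⟨x, rfl⟩ := Submodule.mkQ_surjective _ x
  refine (Submodule.Quotient.mk_eq_zero _).2 fun a ha => ?_
  -- Writing elements of `I` as sums of products `a * b` suffices: `b • x` is killed by `I` by
  -- assumption, hence by `a`.
  rw [← h.eq] at ha
  refine Submodule.smul_induction_on (p := fun a => a • x = 0) ha (fun a ha b hb => ?_)
    fun a b h1 h2 => ?_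
  · rw [smul_eq_mul, mul_smul]
    exact (Submodule.Quotient.mk_eq_zero _).1 (hx b hb) a ha
  · rw [add_smul, h1, h2, add_zero]

/-- In the long exact sequence the group sits between Extⁱ into `T`, zero by membership in 𝕋, and
Extⁱ⁺¹ into the annihilated part, zero by strongness. -/
lemma subsingleton_ext_quotient_annihilated [IsNoetherianRing Λ] (h : IsStrongIdempotent I)
    {T : FGModuleCat.{u} Λ} (hT : T ∈ subcatT I) (i : ℕ) (hi : 1 ≤ i) :
    Subsingleton (Abelian.Ext (ModuleCat.of Λ (Λ ⧸ I)) (ModuleCat.of Λ (T ⧸ annihilated I T)) i) :=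
  subsingleton_ext_of_exact (annihilated I T).subtype (annihilated I T).mkQ
    (Submodule.injective_subtype _) (LinearMap.exact_subtype_mkQ _) (Submodule.mkQ_surjective _)
    _ i (hT i hi) (subsingleton_ext_annihilated I h T (i + 1) (by lia))

omit [I.IsTwoSided] in
lemma isCosyzygy_mem_subcatT {M Q : FGModuleCat.{u} Λ} (hM : M ∈ subcatT I)
    (h : IsCosyzygy M Q) : Q ∈ subcatT I := by
  obtain ⟨J, f, p, hJ, hf, hfp, hp⟩ := h
  exact fun i hi => subsingleton_ext_of_exact f p hf hfp hp _ i
    (subsingleton_ext_of_injective _ hJ i hi) (hM (i + 1) (by lia))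

omit [I.IsTwoSided] in
lemma isDirectSummand_mem_subcatT {N T : FGModuleCat.{u} Λ} (hT : T ∈ subcatT I)
    (h : IsDirectSummand N T) : N ∈ subcatT I := by
  obtain ⟨N', ⟨e⟩⟩ := h
  exact fun i hi => subsingleton_ext_of_retract _
    (e.symm.toLinearMap ∘ₗ LinearMap.inl Λ N N') (LinearMap.fst Λ N N' ∘ₗ e.toLinearMap)
    (fun x => by simp) i (hT i hi)

end StrongIdempotent

/-! ### The corner functor M ↦ eM and coinduction from the corner. -/

section Corner

variable {Λ Γ : Type u} [Ring Λ] [Ring Γ] (c : Γ →ₙ+* Λ)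

/-- The map `c` stands for the inclusion of eΛe into Λ. It is non-unital, and `c 1` plays the role
of e. -/
lemma one_mul_map (γ : Γ) : c 1 * c γ = c γ := by rw [← map_mul, one_mul]

lemma map_mul_one (γ : Γ) : c γ * c 1 = c γ := by rw [← map_mul, mul_one]

/-- The elements of `M` fixed by the idempotent `c 1`, a module over `Γ`. -/
def corner (M : Type*) [AddCommGroup M] [Module Λ M] : AddSubgroup M where
  carrier := {x | c 1 • x = x}
  add_mem' hx hy := by
    change c 1 • (_ + _) = _ + _
    rw [smul_add, hx, hy]
  zero_mem' := smul_zero _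
  neg_mem' hx := by
    change c 1 • (- _) = - _
    rw [smul_neg, hx]

section Module

variable {M N K : Type*} [AddCommGroup M] [Module Λ M] [AddCommGroup N] [Module Λ N]
  [AddCommGroup K] [Module Λ K]

instance : SMul Γ (corner c M) where
  smul γ x := ⟨c γ • (x : M), by
    change c 1 • c γ • (x : M) = c γ • (x : M)
    rw [smul_smul, one_mul_map]⟩

@[simp]
lemma coe_smul_corner (γ : Γ) (x : corner c M) : ((γ • x : corner c M) : M) = c γ • (x : M) := rfl

instance cornerModule : Module Γ (corner c M) where
  one_smul x := Subtype.ext x.2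
  mul_smul γ δ x := Subtype.ext (by simp [mul_smul])
  smul_zero γ := Subtype.ext (by simp)
  smul_add γ x y := Subtype.ext (by simp)
  add_smul γ δ x := Subtype.ext (by simp [add_smul])
  zero_smul x := Subtype.ext (by simp)

/-- Passing to the corner is functorial. -/
def cornerMap (f : M →ₗ[Λ] N) : corner c M →ₗ[Γ] corner c N where
  toFun x := ⟨f x, by
    change c 1 • f x = f x
    rw [← map_smul, show c 1 • (x : M) = x from x.2]⟩
  map_add' x y := Subtype.ext (by simp)
  map_smul' γ x := Subtype.ext (by simp)

lemma smul_mem_corner (x : M) : c 1 • x ∈ corner c M := by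
  change c 1 • c 1 • x = c 1 • x
  rw [smul_smul, one_mul_map]

lemma cornerMap_injective {f : M →ₗ[Λ] N} (hf : Function.Injective f) :
    Function.Injective (cornerMap c f) :=
  fun _ _ h => Subtype.ext (hf (congrArg Subtype.val h))

lemma cornerMap_surjective {f : M →ₗ[Λ] N} (hf : Function.Surjective f) :
    Function.Surjective (cornerMap c f) := by
  rintro ⟨y, hy⟩
  obtain ⟨x, rfl⟩ := hf y
  exact ⟨⟨c 1 • x, smul_mem_corner c x⟩, Subtype.ext ((map_smul f _ _).trans hy)⟩

lemma cornerMap_exact {f : M →ₗ[Λ] N} {g : N →ₗ[Λ] K} (hf : Function.Injective f)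
    (h : Function.Exact f g) : Function.Exact (cornerMap c f) (cornerMap c g) := by
  intro y
  constructor
  · intro hy
    obtain ⟨x, hx⟩ := (h y).1 (congrArg Subtype.val hy)
    refine ⟨⟨x, hf ?_⟩, Subtype.ext hx⟩
    rw [map_smul, hx]
    exact y.2
  · rintro ⟨x, rfl⟩
    exact Subtype.ext ((h _).2 ⟨x, rfl⟩)

end Module

/-- The coinduced module `Hom_Γ(eΛ, J)` for `e = c 1`, realised as the additive maps `Λ → J` that
are compatible with left multiplication by elements of the corner. -/
def coind (J : Type*) [AddCommGroup J] [Module Γ J] : AddSubgroup (Λ →+ J) where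
  carrier := {φ | ∀ γ a, φ (c γ * a) = γ • φ a}
  add_mem' hx hy γ a := by
    rw [AddMonoidHom.add_apply, AddMonoidHom.add_apply, hx, hy, smul_add]
  zero_mem' γ a := by simp
  neg_mem' hx γ a := by
    rw [AddMonoidHom.neg_apply, AddMonoidHom.neg_apply, hx, smul_neg]

section Coind

variable {J : Type*} [AddCommGroup J] [Module Γ J]

instance : SMul Λ (coind c J) where
  smul a φ := ⟨(φ : Λ →+ J).comp (AddMonoidHom.mulRight a), fun γ b => by
    simp only [AddMonoidHom.comp_apply, AddMonoidHom.mulRight_apply, mul_assoc]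
    exact φ.2 _ _⟩

lemma smul_coind_apply (a : Λ) (φ : coind c J) (b : Λ) :
    ((a • φ : coind c J) : Λ →+ J) b = (φ : Λ →+ J) (b * a) := rfl

lemma coind_ext {φ ψ : coind c J} (h : ∀ a, (φ : Λ →+ J) a = (ψ : Λ →+ J) a) : φ = ψ :=
  Subtype.ext (AddMonoidHom.ext h)

lemma coind_apply_map_mul (φ : coind c J) (γ : Γ) (a : Λ) :
    (φ : Λ →+ J) (c γ * a) = γ • (φ : Λ →+ J) a := φ.2 γ a

lemma coind_apply_one_mul (φ : coind c J) (a : Λ) :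
    (φ : Λ →+ J) (c 1 * a) = (φ : Λ →+ J) a := by rw [coind_apply_map_mul, one_smul]

instance coindModule : Module Λ (coind c J) where
  one_smul φ := coind_ext c fun a => by rw [smul_coind_apply, mul_one]
  mul_smul a b φ := coind_ext c fun x => by simp only [smul_coind_apply, mul_assoc]
  smul_zero a := coind_ext c fun x => rfl
  smul_add a φ ψ := coind_ext c fun x => rfl
  add_smul a b φ := coind_ext c fun x => by
    rw [smul_coind_apply, mul_add, map_add]
    rfl
  zero_smul φ := coind_ext c fun x => by
    rw [smul_coind_apply, mul_zero, map_zero]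
    rfl

/-- The homomorphism into a coinduced module that corresponds to a homomorphism from the corner. -/
def toCoind {M : Type*} [AddCommGroup M] [Module Λ M] (k : corner c M →ₗ[Γ] J) :
    M →ₗ[Λ] coind c J where
  toFun x := ⟨AddMonoidHom.mk' (fun a => k ⟨c 1 • a • x, smul_mem_corner c _⟩) fun a b => by
      rw [← map_add]
      exact congrArg k (Subtype.ext (by simp [add_smul])), fun γ a => by
      change k _ = γ • k _
      rw [← map_smul]
      refine congrArg k (Subtype.ext ?_)
      simp only [coe_smul_corner, smul_smul, ← mul_assoc, one_mul_map, map_mul_one]⟩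
  map_add' x y := coind_ext c fun a => by
    change k _ = k _ + k _
    rw [← map_add]
    exact congrArg k (Subtype.ext (by simp))
  map_smul' b x := coind_ext c fun a =>
    congrArg k (Subtype.ext (by simp [mul_smul]))

lemma toCoind_apply {M : Type*} [AddCommGroup M] [Module Λ M] (k : corner c M →ₗ[Γ] J) (x : M)
    (a : Λ) : (toCoind c k x : Λ →+ J) a = k ⟨c 1 • a • x, smul_mem_corner c _⟩ := rfl

end Coind

/-- Coinduction is right adjoint to the corner functor, which preserves injections. -/
lemma injective_coind {J : Type u} [AddCommGroup J] [Module Γ J] (hJ : Module.Injective Γ J) :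
    Module.Injective Λ (coind c J) := by
  refine ⟨fun X Y _ _ _ _ f hf g => ?_⟩
  -- The adjoint of `g`: evaluate at 1.
  let k : corner c X →ₗ[Γ] J :=
    { toFun := fun x => (g x : Λ →+ J) 1
      map_add' := fun x y => by simp
      map_smul' := fun γ x => by
        rw [coe_smul_corner, map_smul, smul_coind_apply, one_mul, ← mul_one (c γ),
          coind_apply_map_mul, RingHom.id_apply] }
  obtain ⟨h, hh⟩ := hJ.out (cornerMap c f) (cornerMap_injective c hf) k
  refine ⟨toCoind c h, fun x => coind_ext c fun a => ?_⟩
  have h1 := hh ⟨c 1 • a • x, smul_mem_corner c _⟩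
  rw [toCoind_apply]
  have h2 : cornerMap c f ⟨c 1 • a • x, smul_mem_corner c _⟩ =
      ⟨c 1 • a • f x, smul_mem_corner c _⟩ := Subtype.ext (by simp [cornerMap])
  rw [← h2, h1]
  change (g (c 1 • a • x) : Λ →+ J) 1 = _
  rw [map_smul, map_smul, smul_coind_apply, smul_coind_apply, one_mul, coind_apply_one_mul]

variable {c}

/-- The corner of Hom_Γ(eΛ, J) is Hom_Γ(eΛe, J), which is J by evaluation at 1; only the retraction
is needed. The map `s` is a ↦ eae, viewed in Γ. -/
lemma injective_corner_coind (hc : Function.Injective c) (s : Λ → Γ)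
    (hs : ∀ a, c (s a) = c 1 * a * c 1) {J : Type u} [AddCommGroup J] [Module Γ J]
    (hJ : Module.Injective Γ J) : Module.Injective Γ (corner c (coind c J)) := by
  have hs_add : ∀ a b, s (a + b) = s a + s b := fun a b => hc (by
    rw [map_add, hs, hs, hs, mul_add, add_mul])
  have hs_mul : ∀ γ a, s (c γ * a) = γ * s a := fun γ a => hc (by
    rw [map_mul, hs, hs, ← mul_assoc, ← mul_assoc, ← mul_assoc, one_mul_map, map_mul_one])
  have hs_map : ∀ γ a, s (a * c γ) = s a * γ := fun γ a => hc (by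
    rw [map_mul, hs, hs, mul_assoc, mul_assoc, mul_assoc, mul_assoc, map_mul_one, one_mul_map])
  have hs_one : s (c 1) = 1 := hc (by rw [hs, one_mul_map, one_mul_map])
  let i : corner c (coind c J) →ₗ[Γ] J :=
    { toFun := fun φ => (φ.1 : Λ →+ J) 1
      map_add' := fun _ _ => rfl
      map_smul' := fun γ φ => by
        rw [coe_smul_corner, smul_coind_apply, one_mul, ← mul_one (c γ), coind_apply_map_mul,
          RingHom.id_apply] }
  let r : J →ₗ[Γ] corner c (coind c J) :=
    { toFun := fun j => ⟨⟨AddMonoidHom.mk' (fun a => s a • j) fun a b => by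
          rw [hs_add, add_smul], fun γ a => by
          simp only [AddMonoidHom.mk'_apply, hs_mul, mul_smul]⟩, coind_ext c fun a => by
          rw [smul_coind_apply]
          change s _ • j = s _ • j
          rw [hs_map, mul_one]⟩
      map_add' := fun x y => Subtype.ext (coind_ext c fun a => smul_add _ _ _)
      map_smul' := fun γ x => Subtype.ext (coind_ext c fun a => by
        rw [RingHom.id_apply, coe_smul_corner, smul_coind_apply]
        change s a • γ • x = s (a * c γ) • x
        rw [hs_map, mul_smul]) }
  refine injective_of_retract hJ i r fun φ => Subtype.ext (coind_ext c fun a => ?_)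
  change s a • (φ.1 : Λ →+ J) 1 = (φ.1 : Λ →+ J) a
  have h2 : c 1 • φ.1 = φ.1 := φ.2
  rw [← coind_apply_map_mul, hs, mul_one]
  conv_rhs => rw [← h2, smul_coind_apply, ← coind_apply_one_mul, ← mul_assoc]

end Corner

/-! ### Injective dimension computed on the corner. -/

section InjectiveDimension

variable {Λ Γ : Type u} [Ring Λ] [Ring Γ] {c : Γ →ₙ+* Λ} {I : Ideal Λ} [I.IsTwoSided]

lemma annihilated_coind (hI : c 1 ∈ I) (J : Type*) [AddCommGroup J] [Module Γ J] :
    annihilated I (coind c J) = ⊥ := by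
  rw [eq_bot_iff]
  intro φ hφ
  refine coind_ext c fun a => ?_
  have := congrArg (fun ψ : coind c J => (ψ : Λ →+ J) 1) (hφ _ (I.mul_mem_right a hI))
  rw [← coind_apply_one_mul, ← one_mul (c 1 * a), ← smul_coind_apply]
  exact this

/-- If `Ext¹(Λ/I, Y) = 0` and `Q` has no nonzero element annihilated by `I`, then neither has the
cokernel of an embedding `Y → Q`. -/
lemma mem_range_of_smul_mem_range {Y Q : Type u} [AddCommGroup Y] [Module Λ Y] [AddCommGroup Q]
    [Module Λ Q] (hY : Subsingleton (Abelian.Ext (ModuleCat.of Λ (Λ ⧸ I)) (ModuleCat.of Λ Y) 1))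
    (hQ : annihilated I Q = ⊥) (f : Y →ₗ[Λ] Q) (hf : Function.Injective f) (x : Q)
    (hx : ∀ a ∈ I, a • x ∈ LinearMap.range f) : x ∈ LinearMap.range f := by
  let e := LinearEquiv.ofInjective f hf
  let g : I →ₗ[Λ] LinearMap.range f :=
    ((LinearMap.toSpanSingleton Λ Q x) ∘ₗ I.subtype).codRestrict _ fun a => hx a a.2
  -- The map `a ↦ a • x` from `I` to `Y` is multiplication by some `y`; then `x - f y` is killed by
  -- `I`, so it is zero.
  obtain ⟨y, hy⟩ := exists_smul_eq_of_ext_one I hY (e.symm.toLinearMap ∘ₗ g)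
  refine ⟨y, (sub_eq_zero.1 ?_).symm⟩
  have : x - f y ∈ annihilated I Q := by
    intro a ha
    have h1 : g ⟨a, ha⟩ = e (a • y) := by
      rw [← hy ⟨a, ha⟩]
      simp
    have h2 : a • x = f (a • y) := congrArg Subtype.val h1
    rw [smul_sub, h2, map_smul, sub_self]
  rw [hQ] at this
  exact this

/-- A kernel element `y` satisfies eΛy = 0. The hypothesis `hIe` encodes that `I` is generated by e
as a two-sided ideal, and so gives Iy = 0. -/
lemma toCoind_injective (hIe : ∀ (Y : Type u) [AddCommGroup Y] [Module Λ Y] (S : Submodule Λ Y)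
    (y : Y), (∀ a : Λ, c 1 • a • y ∈ S) → ∀ a ∈ I, a • y ∈ S)
    {Y J : Type u} [AddCommGroup Y] [Module Λ Y] (hY : annihilated I Y = ⊥)
    [AddCommGroup J] [Module Γ J] (k : corner c Y →ₗ[Γ] J) (hk : Function.Injective k) :
    Function.Injective (toCoind c k) := by
  rw [← LinearMap.ker_eq_bot, eq_bot_iff]
  intro y hy
  rw [← hY]
  refine hIe Y ⊥ y fun a => ?_
  have h1 : k ⟨c 1 • a • y, smul_mem_corner c _⟩ = 0 := by
    rw [← toCoind_apply, LinearMap.mem_ker.1 hy]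
    rfl
  exact congrArg Subtype.val (hk (h1.trans (map_zero k).symm))

/-- If `Ext^i(Λ/I, Y) = 0` for all `i ≥ 0`, then the injective dimension of `Y` is at most that of
the corner of `Y`. -/
lemma hasInjectiveDimensionLT_of_corner (hc : Function.Injective c) (s : Λ → Γ)
    (hs : ∀ a, c (s a) = c 1 * a * c 1) (hI : c 1 ∈ I)
    (hIe : ∀ (Y : Type u) [AddCommGroup Y] [Module Λ Y] (S : Submodule Λ Y)
      (y : Y), (∀ a : Λ, c 1 • a • y ∈ S) → ∀ a ∈ I, a • y ∈ S) (n : ℕ)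
    (Y : Type u) [AddCommGroup Y] [Module Λ Y] (hY : annihilated I Y = ⊥)
    (hext : ∀ i : ℕ, 1 ≤ i →
      Subsingleton (Abelian.Ext (ModuleCat.of Λ (Λ ⧸ I)) (ModuleCat.of Λ Y) i))
    (h : HasInjectiveDimensionLT (ModuleCat.of Γ (corner c Y)) (n + 1)) :
    HasInjectiveDimensionLT (ModuleCat.of Λ Y) (n + 1) := by
  induction n generalizing Y with
  | zero =>
    rw [zero_add, ← injective_iff_hasInjectiveDimensionLT_one,
      ← Module.injective_iff_injective_object] at h ⊢
    have hinj := toCoind_injective hIe hY (LinearMap.id : corner c Y →ₗ[Γ] corner c Y)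
      Function.injective_id
    have hsurj : ∀ φ,
        φ ∈ LinearMap.range (toCoind c (LinearMap.id (R := Γ) (M := corner c Y))) := by
      -- It is enough that eψ is in the range for every ψ = aφ. It is the image of ψ(1), because
      -- (eψ)(b) = ψ(be) = ψ(ebe) = s(b)ψ(1).
      refine fun φ => mem_range_of_smul_mem_range (hext 1 le_rfl) (annihilated_coind hI _) _ hinj φ
        (hIe _ _ _ fun a => ⟨((a • φ : coind c (corner c Y)) : Λ →+ corner c Y) 1,
          coind_ext c fun b => ?_⟩)
      generalize a • φ = ψ
      rw [smul_coind_apply, ← coind_apply_one_mul c ψ (b * c 1), ← mul_assoc, ← hs,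
        ← mul_one (c (s b)), coind_apply_map_mul, toCoind_apply]
      refine Subtype.ext ?_
      rw [coe_smul_corner, hs, mul_smul, mul_smul, show c 1 • ((ψ : Λ →+ corner c Y) 1 : Y) = _
        from ((ψ : Λ →+ corner c Y) 1).2]
      rfl
    let e := LinearEquiv.ofBijective _ ⟨hinj, fun φ => hsurj φ⟩
    exact injective_of_retract (injective_coind c h) e.toLinearMap e.symm.toLinearMap (by simp)
  | succ n ih =>
    obtain ⟨J, k, hJ, hk⟩ := exists_injective_embedding (A := Γ) (corner c Y)
    have hinj := toCoind_injective hIe hY k hk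
    set f := toCoind c k
    have hcoind := injective_coind c hJ
    have hses := shortExact_of_exact f (LinearMap.range f).mkQ hinj
      (LinearMap.exact_map_mkQ_range f) (Submodule.mkQ_surjective _)
    have hses' := shortExact_of_exact _ _ (cornerMap_injective c hinj)
      (cornerMap_exact c hinj (LinearMap.exact_map_mkQ_range f))
      (cornerMap_surjective c (Submodule.mkQ_surjective (LinearMap.range f)))
    -- Dimension shift: the cokernel inherits all the vanishing hypotheses, and its corner is a
    -- cosyzygy of the corner of `Y`, since the corner of the coinduced module is injective.
    refine (hses.hasInjectiveDimensionLT_X₃_iff n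
      ((Module.injective_iff_injective_object _ _).1 hcoind)).1 (ih _ ?_ (fun i hi => ?_) ?_)
    · rw [eq_bot_iff]
      intro x hx
      obtain ⟨x, rfl⟩ := Submodule.mkQ_surjective _ x
      exact (Submodule.Quotient.mk_eq_zero _).2 (mem_range_of_smul_mem_range (hext 1 le_rfl)
        (annihilated_coind hI _) f hinj x
        fun a ha => (Submodule.Quotient.mk_eq_zero _).1 (hx a ha))
    · exact subsingleton_ext_of_exact f (LinearMap.range f).mkQ hinj
        (LinearMap.exact_map_mkQ_range f) (Submodule.mkQ_surjective _) _ i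
        (subsingleton_ext_of_injective _ hcoind i hi) (hext (i + 1) (by lia))
    · exact (hses'.hasInjectiveDimensionLT_X₃_iff n
        ((Module.injective_iff_injective_object _ _).1 (injective_corner_coind hc s hs hJ))).2 h

end InjectiveDimension

/-! ### The algebra Γ as a corner, and the bound by its global dimension. -/

section CornerAlgebra

variable {Λ : Type u} [Ring Λ] {e : Λ}

lemma mul_eq_of_mem_span (he : IsIdempotentElem e) {x : Λ} (hx : x ∈ Ideal.span ({e} : Set Λ)) :
    x * e = x := by
  obtain ⟨a, rfl⟩ := Submodule.mem_span_singleton.1 hx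
  rw [smul_eq_mul, mul_assoc, he.eq]

lemma end_apply_eq (he : IsIdempotentElem e) (f : Module.End Λ (Ideal.span ({e} : Set Λ)))
    (x : Ideal.span ({e} : Set Λ)) :
    (f x : Λ) = x * f ⟨e, Ideal.subset_span rfl⟩ := by
  have : x = (x : Λ) • ⟨e, Ideal.subset_span rfl⟩ :=
    Subtype.ext (mul_eq_of_mem_span he x.2).symm
  conv_lhs => rw [this, map_smul]
  rfl

/-- The identification of `End_Λ(Λe)ᵒᵖ` with `eΛe`. -/
def cornerAlgebraHom (he : IsIdempotentElem e) : cornerAlgebra e →ₙ+* Λ where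
  toFun := fun γ => γ.unop ⟨e, Ideal.subset_span rfl⟩
  map_mul' _ δ := end_apply_eq he δ.unop _
  map_zero' := rfl
  map_add' _ _ := rfl

lemma cornerAlgebraHom_one (he : IsIdempotentElem e) : cornerAlgebraHom he 1 = e := rfl

lemma cornerAlgebraHom_injective (he : IsIdempotentElem e) :
    Function.Injective (cornerAlgebraHom he) := by
  intro γ δ h
  refine MulOpposite.unop_injective (LinearMap.ext fun _ => Subtype.ext ?_)
  rw [end_apply_eq he, end_apply_eq he δ.unop]
  exact congrArg _ h

/-- Right multiplication by `eae` on `Λe`. -/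
def cornerAlgebraMk (e a : Λ) : cornerAlgebra e :=
  MulOpposite.op (((LinearMap.toSpanSingleton Λ Λ (e * a * e)) ∘ₗ
    (Ideal.span ({e} : Set Λ)).subtype).codRestrict _ fun _ =>
      Ideal.mul_mem_left _ _ (Ideal.mul_mem_left _ _ (Ideal.subset_span rfl)))

lemma cornerAlgebraHom_mk (he : IsIdempotentElem e) (a : Λ) :
    cornerAlgebraHom he (cornerAlgebraMk e a) = e * a * e := by
  change e * (e * a * e) = _
  rw [← mul_assoc, ← mul_assoc, he.eq]

/-- This supplies the hypothesis `hIe` for the ideal ΛeΛ, whose elements are sums of products b * e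
* d. -/
lemma smul_mem_of_mem_span {Y : Type*} [AddCommGroup Y] [Module Λ Y] (S : Submodule Λ Y)
    (y : Y) (h : ∀ a : Λ, e • a • y ∈ S) (a : Λ) (ha : a ∈ (TwoSidedIdeal.span {e}).asIdeal) :
    a • y ∈ S := by
  rw [TwoSidedIdeal.mem_asIdeal, TwoSidedIdeal.mem_span_iff_mem_addSubgroup_closure] at ha
  induction ha using AddSubgroup.closure_induction with
  | mem a ha =>
    obtain ⟨_, ⟨b, -, x, rfl, rfl⟩, d, -, rfl⟩ := ha
    simp only [mul_smul]
    exact S.smul_mem _ (h d)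
  | zero => simp
  | add a b _ _ h1 h2 => rw [add_smul]; exact S.add_mem h1 h2
  | neg a _ h1 => rw [neg_smul]; exact S.neg_mem h1

end CornerAlgebra

section GlobalDimension

lemma hasProjectiveDimensionLT_of_pdim_le {A : Type u} [Ring A] {M : ModuleCat.{u} A} {n : ℕ}
    (h : pdim M ≤ n) : HasProjectiveDimensionLT M (n + 1) := by
  refine (projectiveDimension_le_iff M n).1 ?_
  unfold pdim at h
  cases hM : projectiveDimension M with
  | bot => exact bot_le
  | coe d =>
    rw [hM] at h
    exact WithBot.coe_le_coe.2 h

lemma hasInjectiveDimensionLT_of_gldim_le {A : Type u} [Ring A] {n : ℕ} (h : gldim A ≤ n)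
    (M : ModuleCat.{u} A) : HasInjectiveDimensionLT M (n + 1) := by
  rw [hasInjectiveDimensionLT_iff]
  intro i hi Y x
  have := hasProjectiveDimensionLT_of_pdim_le ((le_iSup pdim Y).trans h)
  exact x.eq_zero_of_hasProjectiveDimensionLT (n + 1) hi

variable {Λ : Type u} [Ring Λ]

lemma hasInjectiveDimensionLT_quotient_annihilated [IsNoetherianRing Λ] {e : Λ}
    (he : IsIdempotentElem e) {I : Ideal Λ} [I.IsTwoSided]
    (hI : I = (TwoSidedIdeal.span {e}).asIdeal) (h : IsStrongIdempotent I) {n : ℕ}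
    (hn : gldim (cornerAlgebra e) ≤ n) {T : FGModuleCat.{u} Λ} (hT : T ∈ subcatT I) :
    HasInjectiveDimensionLT (ModuleCat.of Λ (T ⧸ annihilated I T)) (n + 1) :=
  hasInjectiveDimensionLT_of_corner (cornerAlgebraHom_injective he) (cornerAlgebraMk e)
    (cornerAlgebraHom_mk he)
    (by rw [hI, cornerAlgebraHom_one]; exact TwoSidedIdeal.subset_span rfl)
    (fun Y _ _ S y hy => by rw [hI]; exact smul_mem_of_mem_span S y hy) n _
    (annihilated_quotient_eq_bot I h.1 T)
    (fun i hi => subsingleton_ext_quotient_annihilated I h hT i hi)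
    (hasInjectiveDimensionLT_of_gldim_le hn _)

end GlobalDimension

/-! ### Character duality, and injective Λ/I-modules viewed over Λ. -/

section RightDual

variable {Λ : Type u} [Ring Λ]

/-- The character module `Hom_ℤ(N, ℚ/ℤ)` of a right module `N`, as a left module. -/
def RightDual (N : Type u) [AddCommGroup N] : Type u := N →+ AddCircle (1 : ℚ)

instance (N : Type u) [AddCommGroup N] : AddCommGroup (RightDual N) :=
  inferInstanceAs (AddCommGroup (N →+ AddCircle (1 : ℚ)))

instance (N : Type u) [AddCommGroup N] : FunLike (RightDual N) N (AddCircle (1 : ℚ)) :=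
  inferInstanceAs (FunLike (N →+ AddCircle (1 : ℚ)) N (AddCircle (1 : ℚ)))

instance (N : Type u) [AddCommGroup N] :
    AddMonoidHomClass (RightDual N) N (AddCircle (1 : ℚ)) :=
  inferInstanceAs (AddMonoidHomClass (N →+ AddCircle (1 : ℚ)) N (AddCircle (1 : ℚ)))

variable {N N' K : Type u} [AddCommGroup N] [Module Λᵐᵒᵖ N] [AddCommGroup N'] [Module Λᵐᵒᵖ N']
  [AddCommGroup K] [Module Λᵐᵒᵖ K]

instance : SMul Λ (RightDual N) where
  smul a φ := AddMonoidHom.comp φ (DistribSMul.toAddMonoidHom N (MulOpposite.op a))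

lemma smul_rightDual_apply (a : Λ) (φ : RightDual N) (x : N) :
    (a • φ) x = φ (MulOpposite.op a • x) := rfl

omit [Module Λᵐᵒᵖ N] in
lemma rightDual_ext {φ ψ : RightDual N} (h : ∀ x, φ x = ψ x) : φ = ψ := DFunLike.ext _ _ h

instance rightDualModule : Module Λ (RightDual N) where
  one_smul φ := rightDual_ext fun x => by
    rw [smul_rightDual_apply, MulOpposite.op_one, one_smul]
  mul_smul a b φ := rightDual_ext fun x => by
    simp only [smul_rightDual_apply, MulOpposite.op_mul, mul_smul]
  smul_zero a := rfl
  smul_add a φ ψ := rfl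
  add_smul a b φ := rightDual_ext fun x => by
    rw [smul_rightDual_apply, MulOpposite.op_add, add_smul, map_add]
    rfl
  zero_smul φ := rightDual_ext fun x => by
    rw [smul_rightDual_apply, MulOpposite.op_zero, zero_smul, map_zero]
    rfl

/-- Precomposition with a homomorphism of right modules. -/
def rightDualMap (f : N →ₗ[Λᵐᵒᵖ] N') : RightDual N' →ₗ[Λ] RightDual N where
  toFun φ := AddMonoidHom.comp φ f.toAddMonoidHom
  map_add' _ _ := rfl
  map_smul' a φ := rightDual_ext fun x =>
    (congrArg φ (f.map_smul (MulOpposite.op a) x)).symm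

lemma rightDualMap_apply (f : N →ₗ[Λᵐᵒᵖ] N') (φ : RightDual N') (x : N) :
    rightDualMap f φ x = φ (f x) := rfl

lemma rightDualMap_injective {f : N →ₗ[Λᵐᵒᵖ] N'} (hf : Function.Surjective f) :
    Function.Injective (rightDualMap f) := by
  intro φ ψ h
  refine rightDual_ext fun x => ?_
  obtain ⟨x, rfl⟩ := hf x
  exact DFunLike.congr_fun h x

/-- Additive maps to `ℚ/ℤ` extend along injections. -/
lemma exists_addMonoidHom_extension {X Y : Type*} [AddCommGroup X] [AddCommGroup Y] (f : X →+ Y)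
    (hf : Function.Injective f) (g : X →+ AddCircle (1 : ℚ)) :
    ∃ h : Y →+ AddCircle (1 : ℚ), ∀ x, h (f x) = g x := by
  obtain ⟨h, hh⟩ := (Module.Baer.of_divisible (AddCircle (1 : ℚ))).extension_property_addMonoidHom
    f hf g
  exact ⟨h, fun x => DFunLike.congr_fun hh x⟩

lemma rightDualMap_surjective {f : N →ₗ[Λᵐᵒᵖ] N'} (hf : Function.Injective f) :
    Function.Surjective (rightDualMap f) := by
  intro φ
  obtain ⟨h, hh⟩ := exists_addMonoidHom_extension f.toAddMonoidHom hf φ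
  exact ⟨h, rightDual_ext hh⟩

lemma rightDualMap_exact {f : K →ₗ[Λᵐᵒᵖ] N} {g : N →ₗ[Λᵐᵒᵖ] N'} (hfg : Function.Exact f g)
    (hg : Function.Surjective g) : Function.Exact (rightDualMap g) (rightDualMap f) := by
  intro φ
  constructor
  · intro h
    have hker : g.toAddMonoidHom.ker ≤ AddMonoidHom.ker φ := by
      intro x hx
      obtain ⟨k, rfl⟩ := (hfg x).1 hx
      exact DFunLike.congr_fun h k
    exact ⟨g.toAddMonoidHom.liftOfSurjective hg ⟨φ, hker⟩, rightDual_ext fun x =>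
      g.toAddMonoidHom.liftOfRightInverse_comp_apply _
        (Function.rightInverse_surjInv hg) ⟨φ, hker⟩ x⟩
  · rintro ⟨ψ, rfl⟩
    refine rightDual_ext fun x => ?_
    rw [rightDualMap_apply, rightDualMap_apply, hfg.apply_apply_eq_zero, map_zero]
    rfl

/-- The dual of a free right module is injective. -/
lemma injective_rightDual_finsupp (ι : Type u) :
    Module.Injective Λ (RightDual (ι →₀ Λᵐᵒᵖ)) := by
  refine ⟨fun X Y _ _ _ _ f hf g => ?_⟩
  have hex : ∀ i : ι, ∃ h : Y →+ AddCircle (1 : ℚ), ∀ x, h (f x) = g x (Finsupp.single i 1) :=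
    fun i => exists_addMonoidHom_extension f.toAddMonoidHom hf
      (AddMonoidHom.mk' (fun x => g x (Finsupp.single i 1)) fun x y => by rw [map_add]; rfl)
  choose h hh using hex
  -- A map into the dual of a free module is determined by its values on the basis vectors, which
  -- are additive characters; these are extended to `Y` and reassembled linearly.
  let F : Y → ((ι →₀ Λᵐᵒᵖ) →+ AddCircle (1 : ℚ)) := fun y =>
    Finsupp.liftAddHom fun i => AddMonoidHom.mk' (fun m : Λᵐᵒᵖ => h i (m.unop • y)) fun m n => by
      rw [MulOpposite.unop_add, add_smul, map_add]
  have hF : ∀ y i m, F y (Finsupp.single i m) = h i (m.unop • y) := fun y i m =>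
    Finsupp.liftAddHom_apply_single _ _ _
  have hext : ∀ φ ψ : RightDual (ι →₀ Λᵐᵒᵖ),
      (∀ i m, φ (Finsupp.single i m) = ψ (Finsupp.single i m)) → φ = ψ := fun φ ψ h =>
    Finsupp.addHom_ext (f := (φ : (ι →₀ Λᵐᵒᵖ) →+ AddCircle (1 : ℚ))) (g := ψ) h
  refine ⟨⟨⟨F, fun x y => ?_⟩, fun a x => ?_⟩, fun x => ?_⟩
  · refine hext _ _ fun i m => ?_
    change F (x + y) _ = F x _ + F y _
    rw [hF, hF, hF, smul_add, map_add]
  · refine hext _ _ fun i m => ?_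
    change F (a • x) _ = F x (MulOpposite.op a • _)
    rw [Finsupp.smul_single, hF, hF, smul_smul]
    rfl
  · refine hext _ _ fun i m => ?_
    change F (f x) _ = _
    rw [hF, ← map_smul, hh, map_smul, smul_rightDual_apply, Finsupp.smul_single, smul_eq_mul,
      mul_one, MulOpposite.op_unop]

lemma injective_rightDual_of_projective [Module.Projective Λᵐᵒᵖ N] :
    Module.Injective Λ (RightDual N) := by
  obtain ⟨s, hs⟩ := Module.projective_def'.1 (inferInstance : Module.Projective Λᵐᵒᵖ N)
  exact injective_of_retract (injective_rightDual_finsupp N)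
    (rightDualMap (Finsupp.linearCombination Λᵐᵒᵖ id)) (rightDualMap s)
    fun φ => rightDual_ext fun x => congrArg φ (LinearMap.congr_fun hs x)

/-- The injective dimension of the dual is at most the projective dimension. -/
lemma hasInjectiveDimensionLT_rightDual (n : ℕ) (N : Type u) [AddCommGroup N] [Module Λᵐᵒᵖ N]
    (h : HasProjectiveDimensionLT (ModuleCat.of Λᵐᵒᵖ N) (n + 1)) :
    HasInjectiveDimensionLT (ModuleCat.of Λ (RightDual N)) (n + 1) := by
  induction n generalizing N with
  | zero =>
    rw [zero_add, ← projective_iff_hasProjectiveDimensionLT_one,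
      ← IsProjective.iff_projective] at h
    rw [zero_add, ← injective_iff_hasInjectiveDimensionLT_one,
      ← Module.injective_iff_injective_object]
    exact injective_rightDual_of_projective
  | succ n ih =>
    let p : (N →₀ Λᵐᵒᵖ) →ₗ[Λᵐᵒᵖ] N := Finsupp.linearCombination Λᵐᵒᵖ id
    have hp : Function.Surjective p := Finsupp.linearCombination_id_surjective _ _
    have hex : Function.Exact (LinearMap.ker p).subtype p := LinearMap.exact_subtype_ker_map p
    have hinj : Function.Injective (LinearMap.ker p).subtype := Submodule.injective_subtype _
    have hses := shortExact_of_exact (M := LinearMap.ker p) (N := N →₀ Λᵐᵒᵖ) (K := N)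
      (LinearMap.ker p).subtype p hinj hex hp
    have h1 := ih _ ((hses.hasProjectiveDimensionLT_X₃_iff n
      ((IsProjective.iff_projective _).1 inferInstance)).1 h)
    exact ((shortExact_of_exact _ _ (rightDualMap_injective hp) (rightDualMap_exact hex hp)
      (rightDualMap_surjective hinj)).hasInjectiveDimensionLT_X₃_iff n
      ((Module.injective_iff_injective_object _ _).1 (injective_rightDual_finsupp N))).1 h1

end RightDual

section Products

variable {A : Type u} [Ring A]

lemma hasInjectiveDimensionLT_pi (ι : Type u) (n : ℕ) (Y : Type u) [AddCommGroup Y] [Module A Y]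
    (h : HasInjectiveDimensionLT (ModuleCat.of A Y) (n + 1)) :
    HasInjectiveDimensionLT (ModuleCat.of A (ι → Y)) (n + 1) := by
  induction n generalizing Y with
  | zero =>
    rw [zero_add, ← injective_iff_hasInjectiveDimensionLT_one,
      ← Module.injective_iff_injective_object] at h ⊢
    exact Module.Injective.pi A fun _ : ι => Y
  | succ n ih =>
    obtain ⟨Q, f, hQ, hf⟩ := exists_injective_embedding (A := A) Y
    have hex := LinearMap.exact_map_mkQ_range f
    have hsurj := Submodule.mkQ_surjective (LinearMap.range f)
    have h1 := ih _ (((shortExact_of_exact _ _ hf hex hsurj).hasInjectiveDimensionLT_X₃_iff n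
      ((Module.injective_iff_injective_object _ _).1 hQ)).2 h)
    have hpi : Module.Injective A (ι → Q) := Module.Injective.pi A fun _ : ι => Q
    refine ((shortExact_of_exact (f.compLeft ι) ((LinearMap.range f).mkQ.compLeft ι)
      hf.comp_left (fun y => ?_) hsurj.comp_left).hasInjectiveDimensionLT_X₃_iff n
      ((Module.injective_iff_injective_object _ _).1 hpi)).1 h1
    constructor
    · intro hy
      choose x hx using fun i => (hex (y i)).1 (congrFun hy i)
      exact ⟨x, funext hx⟩
    · rintro ⟨x, rfl⟩
      exact funext fun i => hex.apply_apply_eq_zero (x i)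

end Products

section RestrictScalars

variable {Λ : Type u} [Ring Λ] (I : Ideal Λ) [I.IsTwoSided]

/-- An injective `Λ/I`-module has injective dimension over `Λ` at most the projective dimension of
`Λ/I` as a right `Λ`-module. -/
lemma hasInjectiveDimensionLT_restrictScalars {n : ℕ} (hn : pdim (rightQuotient I) ≤ n)
    (J : ModuleCat.{u} (Λ ⧸ I)) (hJ : Module.Injective (Λ ⧸ I) J) :
    HasInjectiveDimensionLT ((ModuleCat.restrictScalars (Ideal.Quotient.mk I)).obj J) (n + 1) := by
  -- Indexing by all characters χ of `J` makes x ↦ (b ↦ χ(b x)) an embedding of `J` into a product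
  -- of duals of `Λ ⧸ I`; it splits because `J` is injective, and the splitting survives restriction
  -- to `Λ`.
  let ι := J →+ AddCircle (1 : ℚ)
  let f : J →ₗ[Λ ⧸ I] (ι → RightDual (Λ ⧸ I)) :=
    { toFun := fun x χ => AddMonoidHom.mk' (fun b : Λ ⧸ I => χ (b • x)) fun a b => by
        rw [add_smul, map_add]
      map_add' := fun x y => funext fun χ => rightDual_ext fun b => by
        change χ (b • (x + y)) = χ (b • x) + χ (b • y)
        rw [smul_add, map_add]
      map_smul' := fun a x => funext fun χ => rightDual_ext fun b => by
        change χ (b • a • x) = χ ((b * a) • x)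
        rw [smul_smul] }
  have hf : Function.Injective f := by
    rw [injective_iff_map_eq_zero]
    intro x hx
    refine CharacterModule.eq_zero_of_character_apply fun χ => ?_
    have h1 : χ ((1 : Λ ⧸ I) • x) = 0 := DFunLike.congr_fun (congrFun hx χ) 1
    rwa [one_smul] at h1
  obtain ⟨r, hr⟩ := hJ.out f hf LinearMap.id
  have hD := hasInjectiveDimensionLT_pi (A := Λ) ι n _
    (hasInjectiveDimensionLT_rightDual n (rightQuotient I) (hasProjectiveDimensionLT_of_pdim_le hn))
  let f' : (ModuleCat.restrictScalars (Ideal.Quotient.mk I)).obj J →ₗ[Λ]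
      (ι → RightDual (rightQuotient I)) :=
    { toFun := f
      map_add' := f.map_add
      map_smul' := fun a x => f.map_smul (Ideal.Quotient.mk I a) x }
  let r' : (ι → RightDual (rightQuotient I)) →ₗ[Λ]
      (ModuleCat.restrictScalars (Ideal.Quotient.mk I)).obj J :=
    { toFun := r
      map_add' := r.map_add
      map_smul' := fun a x => r.map_smul (Ideal.Quotient.mk I a) x }
  exact @Retract.hasInjectiveDimensionLT _ _ _ _ (ModuleCat.of Λ (ι → RightDual (rightQuotient I)))
    ⟨ModuleCat.ofHom f', ModuleCat.ofHom r', ModuleCat.hom_ext (LinearMap.ext hr)⟩ (n + 1) hD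

end RestrictScalars

/-! ### Cosyzygy classes along short exact sequences. -/

section ShortExact

variable {A : Type u} [Ring A]

/-- There is a short exact sequence `0 → X → Y → Z → 0`. -/
def IsShortExact (X Y Z : FGModuleCat.{u} A) : Prop :=
  ∃ (f : X →ₗ[A] Y) (g : Y →ₗ[A] Z), Function.Injective f ∧ Function.Exact f g ∧
    Function.Surjective g

/-- Rotation of a short exact sequence `0 → X → Y → Z → 0` to `0 → Y → I × Z → Ω⁻¹ X → 0`. -/
lemma IsShortExact.rotate (h : HasCosyzygies A) {X Y Z : FGModuleCat.{u} A}
    (hs : IsShortExact X Y Z) : ∃ I X' : FGModuleCat.{u} A, Module.Injective A I ∧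
      IsCosyzygy X X' ∧ IsShortExact Y (FGModuleCat.of A (I × Z)) X' := by
  obtain ⟨f, g, hf, hfg, hg⟩ := hs
  obtain ⟨_, I, a, p, hI, ha, -, -⟩ := h X
  obtain ⟨b, hb⟩ := hI.out f hf a
  -- Here `b` extends `X → I` to `Y`. The cokernel of `k` is the pushout description of `I / X`,
  -- reached from the summand `I`.
  let k : Y →ₗ[A] I × Z := b.prod g
  refine ⟨I, FGModuleCat.of A ((I × Z) ⧸ LinearMap.range k), hI,
    ⟨I, a, (LinearMap.range k).mkQ ∘ₗ LinearMap.inl A I Z, hI, ha, fun i => ?_, fun q => ?_⟩,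
    k, (LinearMap.range k).mkQ, ?_, LinearMap.exact_map_mkQ_range k, Submodule.mkQ_surjective _⟩
  · rw [LinearMap.comp_apply, Submodule.mkQ_apply, Submodule.Quotient.mk_eq_zero]
    constructor
    · rintro ⟨y, hy⟩
      have h1 : b y = i := congrArg Prod.fst hy
      have h2 : g y = 0 := congrArg Prod.snd hy
      obtain ⟨x, rfl⟩ := (hfg y).1 h2
      exact ⟨x, by rw [← hb, h1]⟩
    · rintro ⟨x, rfl⟩
      exact ⟨f x, Prod.ext (hb x) (hfg.apply_apply_eq_zero x)⟩
  · obtain ⟨⟨i, z⟩, rfl⟩ := Submodule.mkQ_surjective _ q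
    obtain ⟨y, rfl⟩ := hg z
    refine ⟨i - b y, (Submodule.Quotient.eq _).2 ⟨-y, ?_⟩⟩
    simp [k]
  · rw [injective_iff_map_eq_zero]
    intro y hy
    obtain ⟨x, rfl⟩ := (hfg y).1 (congrArg Prod.snd hy)
    have h1 : a x = 0 := by
      rw [← hb]
      exact congrArg Prod.fst hy
    rw [(injective_iff_map_eq_zero a).1 ha x h1, map_zero]

lemma cls_injective_prod {I : FGModuleCat.{u} A} (hI : Module.Injective A I)
    (Z : FGModuleCat.{u} A) : cls (FGModuleCat.of A (I × Z)) = cls Z := by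
  rw [cls_prod (LinearEquiv.refl A (I × Z)), cls_injective hI, zero_add]

lemma IsShortExact.cls_eq_of_injective {X Y Z : FGModuleCat.{u} A} (hs : IsShortExact X Y Z)
    (hX : Module.Injective A X) : cls Y = cls Z := by
  obtain ⟨f, g, hf, hfg, hg⟩ := hs
  obtain ⟨r, hr⟩ := hX.out f hf LinearMap.id
  have hbij : Function.Bijective (r.prod g) := by
    constructor
    · rw [injective_iff_map_eq_zero]
      intro y hy
      obtain ⟨x, rfl⟩ := (hfg y).1 (congrArg Prod.snd hy)
      have h1 : x = 0 := (hr x).symm.trans (congrArg Prod.fst hy)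
      rw [h1, map_zero]
    · rintro ⟨x, z⟩
      obtain ⟨y, rfl⟩ := hg z
      refine ⟨y + f (x - r y), Prod.ext ?_ ?_⟩
      · simp [hr]
      · simp [hfg.apply_apply_eq_zero]
  rw [cls_prod (LinearEquiv.ofBijective _ hbij), cls_injective hX, zero_add]

lemma hasInjectiveDimensionLT_injective_prod {I Z : FGModuleCat.{u} A}
    (hI : Module.Injective A I) {n : ℕ} (h : HasInjectiveDimensionLT Z.obj (n + 1)) :
    HasInjectiveDimensionLT (FGModuleCat.of A (I × Z)).obj (n + 1) := by
  have : Injective (ModuleCat.of A I) := (Module.injective_iff_injective_object A I).1 hI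
  exact (shortExact_of_exact (LinearMap.inl A I Z) (LinearMap.snd A I Z) LinearMap.inl_injective
    Function.Exact.inl_snd LinearMap.snd_surjective).hasInjectiveDimensionLT_X₂ (n + 1)
    (hasInjectiveDimensionLT_of_ge (ModuleCat.of A I) 1 (n + 1) (by lia)) h

lemma IsCosyzygy.hasInjectiveDimensionLT {M Q : FGModuleCat.{u} A} (hs : IsCosyzygy M Q) {n : ℕ}
    (h : HasInjectiveDimensionLT M.obj (n + 2)) : HasInjectiveDimensionLT Q.obj (n + 1) := by
  obtain ⟨I, f, p, hI, hf, hfp, hp⟩ := hs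
  exact ((shortExact_of_exact f p hf hfp hp).hasInjectiveDimensionLT_X₃_iff n
    ((Module.injective_iff_injective_object A I).1 hI)).2 h

lemma injective_of_hasInjectiveDimensionLT_one {M : FGModuleCat.{u} A}
    (h : HasInjectiveDimensionLT M.obj 1) : Module.Injective A M :=
  (Module.injective_iff_injective_object A M).2 (injective_iff_hasInjectiveDimensionLT_one.2 h)

lemma iterate_cosyzygyHom_cls_succ (h : HasCosyzygies A) {M Q : FGModuleCat.{u} A}
    (hs : IsCosyzygy M Q) (n : ℕ) :
    (cosyzygyHom A)^[n + 1] (cls M) = (cosyzygyHom A)^[n] (cls Q) := by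
  rw [Function.iterate_succ_apply, cosyzygyHom_cls h hs]

lemma iterate_cosyzygyHom_eq_zero (h : HasCosyzygies A) (n : ℕ) {M : FGModuleCat.{u} A}
    (hM : HasInjectiveDimensionLT M.obj (n + 1)) : (cosyzygyHom A)^[n] (cls M) = 0 := by
  induction n generalizing M with
  | zero => exact cls_injective (injective_of_hasInjectiveDimensionLT_one hM)
  | succ n ih =>
    obtain ⟨Q, hQ⟩ := h M
    rw [iterate_cosyzygyHom_cls_succ h hQ]
    exact ih (hQ.hasInjectiveDimensionLT hM)

/-- In a short exact sequence `0 → X → Y → Z → 0` in which `X` has injective dimension at most `n`,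
the `n`-th cosyzygies of `Y` and `Z` agree. -/
lemma IsShortExact.iterate_eq_of_left (h : HasCosyzygies A) (n : ℕ) {X Y Z : FGModuleCat.{u} A}
    (hs : IsShortExact X Y Z) (hX : HasInjectiveDimensionLT X.obj (n + 1)) :
    (cosyzygyHom A)^[n] (cls Y) = (cosyzygyHom A)^[n] (cls Z) := by
  induction n generalizing X Y Z with
  | zero => exact hs.cls_eq_of_injective (injective_of_hasInjectiveDimensionLT_one hX)
  | succ n ih =>
    -- Three rotations give the sequence of cosyzygies 0 → J × X' → K × Y' → Z' → 0, with `Z'` a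
    -- cosyzygy of `I × Z`; the factors `I`, `J`, `K` are injective and do not affect the classes.
    obtain ⟨I, X', hI, hX', hs'⟩ := hs.rotate h
    obtain ⟨J, Y', hJ, hY', hs''⟩ := hs'.rotate h
    obtain ⟨K, Z', hK, hZ', hs'''⟩ := hs''.rotate h
    have h1 := ih hs''' (hasInjectiveDimensionLT_injective_prod hJ (hX'.hasInjectiveDimensionLT hX))
    rw [cls_injective_prod hK, ← iterate_cosyzygyHom_cls_succ h hY',
      ← iterate_cosyzygyHom_cls_succ h hZ', cls_injective_prod hI] at h1
    exact h1

/-- In a short exact sequence `0 → X → Y → Z → 0` in which `Y` has injective dimension at most `n`,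
the `n`-th cosyzygy of `Z` is the `(n+1)`-st cosyzygy of `X`. -/
lemma IsShortExact.iterate_eq_of_middle (h : HasCosyzygies A) (n : ℕ) {X Y Z : FGModuleCat.{u} A}
    (hs : IsShortExact X Y Z) (hY : HasInjectiveDimensionLT Y.obj (n + 1)) :
    (cosyzygyHom A)^[n + 1] (cls X) = (cosyzygyHom A)^[n] (cls Z) := by
  obtain ⟨I, X', hI, hX', hs'⟩ := hs.rotate h
  rw [iterate_cosyzygyHom_cls_succ h hX', ← hs'.iterate_eq_of_left h n hY, cls_injective_prod hI]

/-- In a short exact sequence `0 → X → Y → Z → 0` in which `Z` has injective dimension at most `n`,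
the `(n+1)`-st cosyzygies of `X` and `Y` agree. -/
lemma IsShortExact.iterate_eq_of_right (h : HasCosyzygies A) (n : ℕ) {X Y Z : FGModuleCat.{u} A}
    (hs : IsShortExact X Y Z) (hZ : HasInjectiveDimensionLT Z.obj (n + 1)) :
    (cosyzygyHom A)^[n + 1] (cls X) = (cosyzygyHom A)^[n + 1] (cls Y) := by
  obtain ⟨I, X', hI, hX', hs'⟩ := hs.rotate h
  rw [hs'.iterate_eq_of_middle h n (hasInjectiveDimensionLT_injective_prod hI hZ),
    iterate_cosyzygyHom_cls_succ h hX']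

end ShortExact

/-! ### The comparison homomorphisms between K₀(Λ) and K₀(Λ/I). -/

section K0

variable {A : Type u} [Ring A]

lemma k0_hom_ext {H : Type*} [AddCommGroup H] {f g : K0 A →+ H}
    (h : ∀ M, f (cls M) = g (cls M)) : f = g :=
  QuotientAddGroup.addMonoidHom_ext _ (FreeAbelianGroup.lift_ext _ _ fun M => h M)

/-- A homomorphism from `K₀` is given by an invariant that is additive on direct sums and vanishes
on injectives. -/
def k0Lift {H : Type*} [AddCommGroup H] (f : FGModuleCat.{u} A → H)
    (hadd : ∀ X Y C : FGModuleCat.{u} A, Nonempty (C ≃ₗ[A] (X × Y)) → f C = f X + f Y)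
    (hinj : ∀ I : FGModuleCat.{u} A, Module.Injective A I → f I = 0) : K0 A →+ H :=
  QuotientAddGroup.lift (AddSubgroup.closure (k0Relations A)) (FreeAbelianGroup.lift f) (by
    rw [AddSubgroup.closure_le]
    rintro x (⟨X, Y, C, e, rfl⟩ | ⟨I, hI, rfl⟩)
    · change FreeAbelianGroup.lift f _ = 0
      rw [map_sub, map_add]
      simp only [FreeAbelianGroup.lift_apply_of]
      rw [hadd X Y C e, sub_self]
    · change FreeAbelianGroup.lift f _ = 0
      simp only [FreeAbelianGroup.lift_apply_of]
      exact hinj I hI)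

lemma k0Lift_cls {H : Type*} [AddCommGroup H] (f : FGModuleCat.{u} A → H)
    (hadd : ∀ X Y C : FGModuleCat.{u} A, Nonempty (C ≃ₗ[A] (X × Y)) → f C = f X + f Y)
    (hinj : ∀ I : FGModuleCat.{u} A, Module.Injective A I → f I = 0) (M : FGModuleCat.{u} A) :
    k0Lift f hadd hinj (cls M) = f M := by
  change FreeAbelianGroup.lift f (FreeAbelianGroup.of M) = _
  simp only [FreeAbelianGroup.lift_apply_of]

end K0

section Annihilated

variable {Λ : Type u} [Ring Λ] (I : Ideal Λ) [I.IsTwoSided]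

/-- Restriction of a homomorphism to the elements annihilated by `I`. -/
def annihilatedMap {M N : Type*} [AddCommGroup M] [Module Λ M] [AddCommGroup N] [Module Λ N]
    (f : M →ₗ[Λ] N) : annihilated I M →ₗ[Λ ⧸ I] annihilated I N where
  toFun x := ⟨f x, fun a ha => by rw [← map_smul, x.2 a ha, map_zero]⟩
  map_add' x y := Subtype.ext (f.map_add x y)
  map_smul' a x := by
    obtain ⟨a, rfl⟩ := Ideal.Quotient.mk_surjective a
    exact Subtype.ext (f.map_smul a x)

lemma annihilatedMap_injective {M N : Type*} [AddCommGroup M] [Module Λ M] [AddCommGroup N]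
    [Module Λ N] {f : M →ₗ[Λ] N} (hf : Function.Injective f) :
    Function.Injective (annihilatedMap I f) :=
  fun _ _ h => Subtype.ext (hf (congrArg Subtype.val h))

/-- Taking the elements annihilated by `I` commutes with direct sums. -/
noncomputable def annihilatedProd {M X Y : Type*} [AddCommGroup M] [Module Λ M]
    [AddCommGroup X] [Module Λ X] [AddCommGroup Y] [Module Λ Y] (e : M ≃ₗ[Λ] (X × Y)) :
    annihilated I M ≃ₗ[Λ ⧸ I] (annihilated I X × annihilated I Y) :=
  LinearEquiv.ofBijective
    ((annihilatedMap I (LinearMap.fst Λ X Y ∘ₗ e.toLinearMap)).prod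
      (annihilatedMap I (LinearMap.snd Λ X Y ∘ₗ e.toLinearMap))) (by
    constructor
    · intro x y h
      refine Subtype.ext (e.injective (Prod.ext ?_ ?_))
      · exact congrArg (fun z => (z.1 : X)) h
      · exact congrArg (fun z => (z.2 : Y)) h
    · rintro ⟨⟨x, hx⟩, ⟨y, hy⟩⟩
      refine ⟨⟨e.symm (x, y), fun a ha => ?_⟩, ?_⟩
      · rw [← map_smul, Prod.smul_mk, hx a ha, hy a ha]
        exact map_zero _
      · refine Prod.ext (Subtype.ext ?_) (Subtype.ext ?_)
        · simp [annihilatedMap]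
        · simp [annihilatedMap])

/-- The functor is right adjoint to restriction of scalars, which preserves injections. -/
lemma injective_annihilated {J : Type u} [AddCommGroup J] [Module Λ J]
    (hJ : Module.Injective Λ J) : Module.Injective (Λ ⧸ I) (annihilated I J) := by
  refine ⟨fun X Y _ _ _ _ f hf g => ?_⟩
  let _ : Module Λ X := Module.compHom X (Ideal.Quotient.mk I)
  let _ : Module Λ Y := Module.compHom Y (Ideal.Quotient.mk I)
  let f' : X →ₗ[Λ] Y :=
    { toFun := f
      map_add' := f.map_add
      map_smul' := fun a x => f.map_smul (Ideal.Quotient.mk I a) x }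
  let g' : X →ₗ[Λ] J :=
    { toFun := fun x => (g x : J)
      map_add' := fun x y => by simp
      map_smul' := fun a x => congrArg Subtype.val (g.map_smul (Ideal.Quotient.mk I a) x) }
  obtain ⟨h, hh⟩ := hJ.out f' hf g'
  have hmem : ∀ y, h y ∈ annihilated I J := fun y a ha => by
    have h1 : a • y = 0 := by
      change Ideal.Quotient.mk I a • y = 0
      rw [Ideal.Quotient.eq_zero_iff_mem.2 ha, zero_smul]
    rw [← map_smul, h1, map_zero]
  refine ⟨⟨⟨fun y => ⟨h y, hmem y⟩, fun x y => Subtype.ext (h.map_add x y)⟩, fun a y => ?_⟩,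
    fun x => Subtype.ext (hh x)⟩
  obtain ⟨a, rfl⟩ := Ideal.Quotient.mk_surjective a
  exact Subtype.ext (h.map_smul a y)

variable [IsNoetherianRing Λ]

/-- The finitely generated `Λ/I`-module of the elements annihilated by `I`. -/
def annihilatedFG (M : FGModuleCat.{u} Λ) : FGModuleCat.{u} (Λ ⧸ I) :=
  FGModuleCat.of (Λ ⧸ I) (annihilated I M)

/-- The homomorphism `K₀(Λ) → K₀(Λ/I)` induced by `Hom_Λ(Λ/I, -)`. -/
noncomputable def annihilatedHom : K0 Λ →+ K0 (Λ ⧸ I) :=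
  k0Lift (fun M => cls (annihilatedFG I M))
    (fun X Y _ ⟨e⟩ => cls_prod (X := annihilatedFG I X) (Y := annihilatedFG I Y)
      (annihilatedProd I e))
    (fun _ hJ => cls_injective (injective_annihilated I hJ))

lemma annihilatedHom_cls (M : FGModuleCat.{u} Λ) :
    annihilatedHom I (cls M) = cls (annihilatedFG I M) := k0Lift_cls _ _ _ _

/-- Only surjectivity onto the annihilated part of `Q` needs membership in 𝕋: the obstruction to
lifting lies in Ext¹(Λ/I, M). -/
lemma isCosyzygy_annihilated {M Q : FGModuleCat.{u} Λ} (hM : M ∈ subcatT I)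
    (h : IsCosyzygy M Q) : IsCosyzygy (annihilatedFG I M) (annihilatedFG I Q) := by
  obtain ⟨J, f, p, hJ, hf, hfp, hp⟩ := h
  refine ⟨annihilatedFG I J, annihilatedMap I f, annihilatedMap I p, injective_annihilated I hJ,
    annihilatedMap_injective I hf, fun x => ⟨fun hx => ?_, ?_⟩, fun q => ?_⟩
  · obtain ⟨m, hm⟩ := (hfp x.1).1 (congrArg Subtype.val hx)
    exact ⟨⟨m, fun a ha => hf (by rw [map_smul, hm, map_zero]; exact x.2 a ha)⟩, Subtype.ext hm⟩
  · rintro ⟨m, rfl⟩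
    exact Subtype.ext (hfp.apply_apply_eq_zero m.1)
  · obtain ⟨x, hx⟩ := hp q.1
    have hmem : ∀ a : I, (a : Λ) • x ∈ LinearMap.range f := fun a =>
      (hfp _).1 (by rw [map_smul, hx]; exact q.2 a a.2)
    let e := LinearEquiv.ofInjective f hf
    obtain ⟨m, hm⟩ := exists_smul_eq_of_ext_one I (hM 1 le_rfl) (e.symm.toLinearMap ∘ₗ
      ((LinearMap.toSpanSingleton Λ J x) ∘ₗ I.subtype).codRestrict _ hmem)
    refine ⟨⟨x - f m, fun a ha => ?_⟩, Subtype.ext ?_⟩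
    · have h1 := congrArg e (hm ⟨a, ha⟩)
      rw [LinearMap.comp_apply, LinearEquiv.coe_coe, LinearEquiv.apply_symm_apply] at h1
      have h2 : a • x = f (a • m) := congrArg Subtype.val h1
      rw [smul_sub, h2, map_smul, sub_self]
    · change p (x - f m) = q.1
      rw [map_sub, hx, hfp.apply_apply_eq_zero, sub_zero]

/-- The subgroup of `K₀` generated by the classes of the modules in `𝕋`. -/
def subcatTSpan : AddSubgroup (K0 Λ) := AddSubgroup.closure (cls '' subcatT I)

omit [I.IsTwoSided] [IsNoetherianRing Λ] in
lemma cosyzygyHom_mem_subcatTSpan (h : HasCosyzygies Λ) {x : K0 Λ} (hx : x ∈ subcatTSpan I) :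
    cosyzygyHom Λ x ∈ subcatTSpan I := by
  have : subcatTSpan I ≤ (subcatTSpan I).comap (cosyzygyHom Λ) := by
    refine (AddSubgroup.closure_le _).2 ?_
    rintro _ ⟨T, hT, rfl⟩
    obtain ⟨Q, hQ⟩ := h T
    change cosyzygyHom Λ (cls T) ∈ subcatTSpan I
    rw [cosyzygyHom_cls h hQ]
    exact AddSubgroup.subset_closure ⟨Q, isCosyzygy_mem_subcatT I hT hQ, rfl⟩
  exact this hx

lemma annihilatedHom_cosyzygyHom (h : HasCosyzygies Λ) (h' : HasCosyzygies (Λ ⧸ I)) {x : K0 Λ}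
    (hx : x ∈ subcatTSpan I) :
    annihilatedHom I (cosyzygyHom Λ x) = cosyzygyHom (Λ ⧸ I) (annihilatedHom I x) := by
  induction hx using AddSubgroup.closure_induction with
  | mem x hx =>
    obtain ⟨T, hT, rfl⟩ := hx
    obtain ⟨Q, hQ⟩ := h T
    rw [cosyzygyHom_cls h hQ, annihilatedHom_cls, annihilatedHom_cls,
      cosyzygyHom_cls h' (isCosyzygy_annihilated I hT hQ)]
  | zero => simp only [map_zero]
  | add x y _ _ h1 h2 => simp only [map_add, h1, h2]
  | neg x _ h1 => simp only [map_neg, h1]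

lemma annihilatedHom_iterate (h : HasCosyzygies Λ) (h' : HasCosyzygies (Λ ⧸ I)) (n : ℕ) {x : K0 Λ}
    (hx : x ∈ subcatTSpan I) :
    annihilatedHom I ((cosyzygyHom Λ)^[n] x) =
      (cosyzygyHom (Λ ⧸ I))^[n] (annihilatedHom I x) := by
  induction n generalizing x with
  | zero => rfl
  | succ n ih =>
    rw [Function.iterate_succ_apply, ih (cosyzygyHom_mem_subcatTSpan I h hx),
      annihilatedHom_cosyzygyHom I h h' hx, Function.iterate_succ_apply]

end Annihilated

section Restriction

variable {Λ : Type u} [Ring Λ] (I : Ideal Λ) [I.IsTwoSided]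

/-- A finitely generated `Λ/I`-module as a `Λ`-module. -/
noncomputable def restrictFG (X : FGModuleCat.{u} (Λ ⧸ I)) : FGModuleCat.{u} Λ :=
  ⟨(ModuleCat.restrictScalars (Ideal.Quotient.mk I)).obj X.obj, by
    obtain ⟨s, hs⟩ := X.property
    refine ⟨s, eq_top_iff.2 fun x _ => ?_⟩
    have hx : x ∈ Submodule.span (Λ ⧸ I) (s : Set X) := hs ▸ trivial
    induction hx using Submodule.span_induction with
    | mem x hx => exact Submodule.subset_span hx
    | zero => exact Submodule.zero_mem _
    | add x y _ _ h1 h2 => exact Submodule.add_mem _ (h1 trivial) (h2 trivial)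
    | smul a x _ h1 =>
      obtain ⟨a, rfl⟩ := Ideal.Quotient.mk_surjective a
      exact Submodule.smul_mem _ a (h1 trivial)⟩

/-- A `Λ/I`-linear map as a `Λ`-linear map. -/
noncomputable def restrictMap {X Y : FGModuleCat.{u} (Λ ⧸ I)} (f : X →ₗ[Λ ⧸ I] Y) :
    restrictFG I X →ₗ[Λ] restrictFG I Y :=
  ((ModuleCat.restrictScalars (Ideal.Quotient.mk I)).map (ModuleCat.ofHom f)).hom

/-- Restriction of scalars commutes with direct sums. -/
noncomputable def restrictProd {X Y C : FGModuleCat.{u} (Λ ⧸ I)} (e : C ≃ₗ[Λ ⧸ I] (X × Y)) :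
    restrictFG I C ≃ₗ[Λ] (restrictFG I X × restrictFG I Y) where
  toFun := e
  invFun := e.symm
  left_inv := e.left_inv
  right_inv := e.right_inv
  map_add' := e.map_add
  map_smul' a x := e.map_smul (Ideal.Quotient.mk I a) x

lemma hasInjectiveDimensionLT_restrictFG {d : ℕ} (hd : pdim (rightQuotient I) ≤ d)
    {J : FGModuleCat.{u} (Λ ⧸ I)} (hJ : Module.Injective (Λ ⧸ I) J) :
    HasInjectiveDimensionLT (restrictFG I J).obj (d + 1) :=
  hasInjectiveDimensionLT_restrictScalars I hd J.obj hJ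

/-- The homomorphism `K₀(Λ/I) → K₀(Λ)`, `[X] ↦ [Ω⁻ᵈ X]`, for `d` at least the projective dimension
of `Λ/I` as a right `Λ`-module. -/
noncomputable def restrictHom (h : HasCosyzygies Λ) {d : ℕ} (hd : pdim (rightQuotient I) ≤ d) :
    K0 (Λ ⧸ I) →+ K0 Λ :=
  k0Lift (fun X => (cosyzygyHom Λ)^[d] (cls (restrictFG I X)))
    (fun X Y _ ⟨e⟩ => by
      rw [cls_prod (restrictProd I e), iterate_map_add])
    -- The shift by `d` is what kills injective `Λ ⧸ I`-modules, which need not be injective over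
    -- `Λ`.
    (fun _ hJ => iterate_cosyzygyHom_eq_zero h d (hasInjectiveDimensionLT_restrictFG I hd hJ))

lemma restrictHom_cls (h : HasCosyzygies Λ) {d : ℕ} (hd : pdim (rightQuotient I) ≤ d)
    (X : FGModuleCat.{u} (Λ ⧸ I)) :
    restrictHom I h hd (cls X) = (cosyzygyHom Λ)^[d] (cls (restrictFG I X)) := k0Lift_cls _ _ _ _

/-- Over `Λ` the middle term of a cosyzygy sequence 0 → X → J → Q → 0 of `Λ ⧸ I`-modules has
injective dimension at most `d`, so Ω⁻⁽ᵈ⁺¹⁾ of `X` agrees with Ω⁻ᵈ of `Q`. -/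
lemma restrictHom_cosyzygyHom (h : HasCosyzygies Λ) (h' : HasCosyzygies (Λ ⧸ I)) {d : ℕ}
    (hd : pdim (rightQuotient I) ≤ d) (y : K0 (Λ ⧸ I)) :
    restrictHom I h hd (cosyzygyHom (Λ ⧸ I) y) = cosyzygyHom Λ (restrictHom I h hd y) := by
  suffices (restrictHom I h hd).comp (cosyzygyHom (Λ ⧸ I)) =
      (cosyzygyHom Λ).comp (restrictHom I h hd) from DFunLike.congr_fun this y
  refine k0_hom_ext fun X => ?_
  obtain ⟨Q, hQ⟩ := h' X
  rw [AddMonoidHom.comp_apply, AddMonoidHom.comp_apply, cosyzygyHom_cls h' hQ, restrictHom_cls,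
    restrictHom_cls, ← Function.iterate_succ_apply' (cosyzygyHom Λ)]
  obtain ⟨J, f, p, hJ, hf, hfp, hp⟩ := hQ
  have hs : IsShortExact (restrictFG I X) (restrictFG I J) (restrictFG I Q) :=
    ⟨restrictMap I f, restrictMap I p, hf, hfp, hp⟩
  exact (hs.iterate_eq_of_middle h d (hasInjectiveDimensionLT_restrictFG I hd hJ)).symm

lemma restrictHom_iterate (h : HasCosyzygies Λ) (h' : HasCosyzygies (Λ ⧸ I)) {d : ℕ}
    (hd : pdim (rightQuotient I) ≤ d) (n : ℕ) (y : K0 (Λ ⧸ I)) :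
    restrictHom I h hd ((cosyzygyHom (Λ ⧸ I))^[n] y) =
      (cosyzygyHom Λ)^[n] (restrictHom I h hd y) := by
  induction n generalizing y with
  | zero => rfl
  | succ n ih =>
    rw [Function.iterate_succ_apply, ih, restrictHom_cosyzygyHom I h h',
      Function.iterate_succ_apply]

/-- Beyond the global dimension of the corner algebra, the cosyzygies of `T ∈ 𝕋` and of
`Hom_Λ(Λ/I, T)` agree. -/
lemma iterate_restrictHom_annihilatedHom [IsNoetherianRing Λ] (h : HasCosyzygies Λ) {d g k : ℕ}
    (hd : pdim (rightQuotient I) ≤ d)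
    (hg : ∀ T ∈ subcatT I,
      HasInjectiveDimensionLT (ModuleCat.of Λ (T ⧸ annihilated I T)) (g + 1))
    (hk : g + 1 ≤ k + d) {x : K0 Λ} (hx : x ∈ subcatTSpan I) :
    (cosyzygyHom Λ)^[k] (restrictHom I h hd (annihilatedHom I x)) =
      (cosyzygyHom Λ)^[k + d] x := by
  induction hx using AddSubgroup.closure_induction with
  | mem x hx =>
    obtain ⟨T, hT, rfl⟩ := hx
    have hs : IsShortExact (restrictFG I (annihilatedFG I T)) T
        (FGModuleCat.of Λ (T ⧸ annihilated I T)) :=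
      ⟨(annihilated I T).subtype, (annihilated I T).mkQ, Submodule.injective_subtype _,
        LinearMap.exact_subtype_mkQ _, Submodule.mkQ_surjective _⟩
    -- Bounding the right-hand term by `g` gives agreement only from step `g + 1`: this is the
    -- source of the summand 1 in the bound.
    have h1 := hs.iterate_eq_of_right h g (hg T hT)
    obtain ⟨j, hj⟩ := Nat.exists_eq_add_of_le' hk
    rw [annihilatedHom_cls, restrictHom_cls, ← Function.iterate_add_apply, hj,
      Function.iterate_add_apply, h1, ← Function.iterate_add_apply]
  | zero => simp only [map_zero, iterate_map_zero]
  | add x y _ _ h1 h2 => simp only [map_add, iterate_map_add, h1, h2]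
  | neg x _ h1 => simp only [map_neg, iterate_map_neg, h1]

end Restriction

/-! ### The subgroups ⟨add M⟩ and the function φ_r. -/

section AddSpan

variable {A : Type u} [Ring A]

lemma IsDirectSummand.trans {X Y Z : FGModuleCat.{u} A} (h : IsDirectSummand X Y)
    (h' : IsDirectSummand Y Z) : IsDirectSummand X Z := by
  obtain ⟨U, ⟨e⟩⟩ := h
  obtain ⟨V, ⟨e'⟩⟩ := h'
  exact ⟨FGModuleCat.of A (U × V),
    ⟨e' ≪≫ₗ (e.prodCongr (LinearEquiv.refl A V)) ≪≫ₗ LinearEquiv.prodAssoc A X U V⟩⟩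

/-- The class of every direct summand of `X` lies in `⟨add X⟩`. -/
lemma cls_mem_addSpan [IsArtinianRing A] {X N : FGModuleCat.{u} A} (h : IsDirectSummand N X) :
    cls N ∈ addSpan X := by
  -- Induction on length: a decomposable module splits into two summands of smaller finite length.
  induction hn : Module.length A N using WellFoundedLT.induction generalizing N with
  | ind n ih =>
    by_cases hN : IsIndecomposable N
    · exact AddSubgroup.subset_closure ⟨N, h, hN, rfl⟩
    by_cases hN0 : Nontrivial N
    · unfold IsIndecomposable at hN
      push Not at hN
      obtain ⟨Y, Z, ⟨e⟩, hY, hZ⟩ := hN hN0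
      have hfin : Module.length A N ≠ ⊤ := Module.length_ne_top
      have hlen : Module.length A N = Module.length A Y + Module.length A Z := by
        rw [e.length_eq, Module.length_prod]
      rw [hlen] at hfin
      have hYpos : 0 < Module.length A Y := Module.length_pos
      have hZpos : 0 < Module.length A Z := Module.length_pos
      rw [cls_prod e]
      refine AddSubgroup.add_mem _ (ih _ ?_ (IsDirectSummand.trans ⟨Z, ⟨e⟩⟩ h) rfl)
        (ih _ ?_ (IsDirectSummand.trans ⟨Y, ⟨e ≪≫ₗ LinearEquiv.prodComm A Y Z⟩⟩ h) rfl)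
      · rw [← hn, hlen]
        simpa using (ENat.add_lt_add_iff_left (fun h => hfin (by rw [h, top_add]))).2 hZpos
      · rw [← hn, hlen]
        simpa using (ENat.add_lt_add_iff_right (fun h => hfin (by rw [h, add_top]))).2 hYpos
    · rw [not_nontrivial_iff_subsingleton] at hN0
      rw [cls_injective ⟨fun _ _ _ _ _ _ _ _ _ => ⟨0, fun _ => Subsingleton.elim _ _⟩⟩]
      exact AddSubgroup.zero_mem _

lemma mem_cosyzygySpan {M : FGModuleCat.{u} A} {s : ℕ} {x : K0 A} :
    x ∈ cosyzygySpan M s ↔ ∃ y ∈ addSpan M, (cosyzygyHom A)^[s] y = x := by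
  induction s generalizing x with
  | zero => simp [cosyzygySpan]
  | succ s ih =>
    simp only [cosyzygySpan, AddSubgroup.mem_map, ih, Function.iterate_succ_apply']
    constructor
    · rintro ⟨_, ⟨y, hy, rfl⟩, rfl⟩
      exact ⟨y, hy, rfl⟩
    · rintro ⟨y, hy, rfl⟩
      exact ⟨_, ⟨y, hy, rfl⟩, rfl⟩

/-- Surjectivity holds by definition of the spans, so only injectivity, a statement about kernels,
has to be checked. -/
lemma phiR_le {M : FGModuleCat.{u} A} {n : ℕ} (h : ∀ s : ℕ, n ≤ s → ∀ x ∈ addSpan M,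
    (cosyzygyHom A)^[s + 1] x = 0 → (cosyzygyHom A)^[s] x = 0) : phiR M ≤ n := by
  refine iInf₂_le n fun s hs => ⟨fun x hx => ⟨x, hx, rfl⟩, fun x hx y hy hxy => ?_, ?_⟩
  · have hsub : x - y ∈ cosyzygySpan M s := AddSubgroup.sub_mem _ hx hy
    obtain ⟨z, hz, hzxy⟩ := mem_cosyzygySpan.1 hsub
    have h0 := h s hs z hz (by
      rw [Function.iterate_succ_apply', hzxy, map_sub, sub_eq_zero]
      exact hxy)
    exact sub_eq_zero.1 (hzxy.symm.trans h0)
  · rintro _ ⟨x, hx, rfl⟩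
    exact ⟨x, hx, rfl⟩

lemma iterate_eq_zero_of_phiR_le {M : FGModuleCat.{u} A} {n : ℕ} (h : phiR M ≤ n) {x : K0 A}
    (hx : x ∈ addSpan M) (s t : ℕ) (hs : n ≤ s) (h0 : (cosyzygyHom A)^[s + t] x = 0) :
    (cosyzygyHom A)^[s] x = 0 := by
  -- A strict bound on the infimum produces an admissible index m < n + 1.
  have hlt : phiR M < ((n + 1 : ℕ) : ℕ∞) := h.trans_lt (by exact_mod_cast Nat.lt_succ_self n)
  unfold phiR at hlt
  simp only [iInf_lt_iff] at hlt
  obtain ⟨m, hm, hmn⟩ := hlt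
  have hmn' : m ≤ n := Nat.lt_succ_iff.1 (by exact_mod_cast hmn)
  induction t with
  | zero => exact h0
  | succ t ih =>
    refine ih ((hm (s + t) (by lia)).injOn (mem_cosyzygySpan.2 ⟨x, hx, rfl⟩)
      (AddSubgroup.zero_mem _) ?_)
    rw [map_zero, ← Function.iterate_succ_apply' (cosyzygyHom A)]
    exact h0

end AddSpan

section Main

variable {Λ : Type u} [Ring Λ] (I : Ideal Λ) [I.IsTwoSided]

omit [I.IsTwoSided] in
lemma addSpan_le_subcatTSpan {T : FGModuleCat.{u} Λ} (hT : T ∈ subcatT I) :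
    addSpan T ≤ subcatTSpan I := by
  refine (AddSubgroup.closure_le _).2 ?_
  rintro _ ⟨N, hN, -, rfl⟩
  exact AddSubgroup.subset_closure ⟨N, isDirectSummand_mem_subcatT I hT hN, rfl⟩

/-- The annihilated part of an indecomposable summand is a summand but may decompose, so
`cls_mem_addSpan` is needed for arbitrary summands. -/
lemma annihilatedHom_mem_addSpan [IsNoetherianRing Λ] [IsArtinianRing (Λ ⧸ I)]
    {T : FGModuleCat.{u} Λ} {x : K0 Λ} (hx : x ∈ addSpan T) :
    annihilatedHom I x ∈ addSpan (annihilatedFG I T) := by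
  have : addSpan T ≤ (addSpan (annihilatedFG I T)).comap (annihilatedHom I) := by
    refine (AddSubgroup.closure_le _).2 ?_
    rintro _ ⟨N, ⟨N', ⟨e⟩⟩, -, rfl⟩
    change annihilatedHom I (cls N) ∈ addSpan (annihilatedFG I T)
    rw [annihilatedHom_cls]
    exact cls_mem_addSpan ⟨annihilatedFG I N', ⟨annihilatedProd I e⟩⟩
  exact this hx

end Main

end IgusaTodorov

theorem proposition4p9 {R : Type v} {Λ : Type u} [CommRing R] [IsArtinianRing R] [Ring Λ]
    [Algebra R Λ] [Module.Finite R Λ] (e : Λ) (he : IsIdempotentElem e)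
    (𝔄 : Ideal Λ) [𝔄.IsTwoSided] (h𝔄 : 𝔄 = (TwoSidedIdeal.span {e}).asIdeal)
    (hstrong : IgusaTodorov.IsStrongIdempotent 𝔄) :
    IgusaTodorov.phiRDimOn (IgusaTodorov.subcatT 𝔄) ≤
      max (IgusaTodorov.gldim (IgusaTodorov.cornerAlgebra e) + 1)
        (IgusaTodorov.phiRDim (Λ ⧸ 𝔄) +
          IgusaTodorov.pdim (IgusaTodorov.rightQuotient 𝔄)) := by
  open IgusaTodorov in
  have : IsArtinianRing Λ := IsArtinianRing.of_finite R Λ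
  have : Module.Finite R (Λ ⧸ 𝔄) :=
    Module.Finite.of_surjective (Ideal.Quotient.mkₐ R 𝔄).toLinearMap Ideal.Quotient.mk_surjective
  have : IsArtinianRing (Λ ⧸ 𝔄) := IsArtinianRing.of_finite R (Λ ⧸ 𝔄)
  have hΛ := hasCosyzygies R Λ
  have hB := hasCosyzygies R (Λ ⧸ 𝔄)
  obtain hg | hg := eq_or_ne (gldim (cornerAlgebra e)) ⊤
  · simp [hg]
  obtain hm | hm := eq_or_ne (phiRDim (Λ ⧸ 𝔄)) ⊤
  · simp [hm]
  obtain hd | hd := eq_or_ne (pdim (rightQuotient 𝔄)) ⊤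
  · simp [hd]
  obtain ⟨g, hg⟩ := ENat.ne_top_iff_exists.1 hg
  obtain ⟨m, hm⟩ := ENat.ne_top_iff_exists.1 hm
  obtain ⟨d, hd⟩ := ENat.ne_top_iff_exists.1 hd
  rw [← hg, ← hm, ← hd]
  refine iSup₂_le fun T hT => ?_
  have hbound : max ((g : ℕ∞) + 1) (m + d) = ((max (g + 1) (m + d) : ℕ) : ℕ∞) := rfl
  rw [hbound]
  refine phiR_le fun s hs x hx h0 => ?_
  -- Write s = k + d: the `d` cosyzygies are absorbed by `restrictHom`, and the remaining `k ≥ m`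
  -- lie in the range where Ω⁻¹ is injective over `Λ ⧸ 𝔄`.
  obtain ⟨k, rfl⟩ := Nat.exists_eq_add_of_le'
    ((Nat.le_add_left d m).trans ((le_max_right _ _).trans hs))
  have hkm : m ≤ k := by have := (le_max_right (g + 1) (m + d)).trans hs; lia
  have hkg : g + 1 ≤ k + d := (le_max_left _ _).trans hs
  have hxT := addSpan_le_subcatTSpan 𝔄 hT hx
  rw [← iterate_restrictHom_annihilatedHom 𝔄 hΛ hd.ge
    (fun T hT => hasInjectiveDimensionLT_quotient_annihilated he h𝔄 hstrong hg.ge hT) hkg hxT,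
    ← restrictHom_iterate 𝔄 hΛ hB]
  have hphi : phiR (annihilatedFG 𝔄 T) ≤ m := by
    rw [hm]
    exact le_iSup₂ (f := fun X (_ : X ∈ Set.univ) => phiR X) (annihilatedFG 𝔄 T) trivial
  -- Over `Λ ⧸ 𝔄` the hypothesis kills the class after k + (d + 1) = s + 1 cosyzygies, and
  -- injectivity brings this down to `k`.
  rw [iterate_eq_zero_of_phiR_le hphi (annihilatedHom_mem_addSpan 𝔄 hx) k (d + 1) hkm, map_zero]
  rw [← add_assoc, ← annihilatedHom_iterate 𝔄 hΛ hB _ hxT, h0, map_zero]
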